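/- Let $\mathcal H$ be a separable complex Hilbert space, $T>0$, $I=(0,T)$ and $u_0\in\mathcal H$. Let $H_0$ be a (possibly unbounded) self-adjoint operator on $\mathcal H$ with domain $D(H_0)$, let $W$ be a closed symmetric operator on $\mathcal H$ with $D(H_0)\subset D(W)$, and assume that there is $\varepsilon>0$ with $$\sup_{\lambda\in\mathbb R}\big\|W(H_0-\lambda\pm i\varepsilon)^{-1}\big\|_{\mathcal L(\mathcal H)}<1 .$$ Let $(B(t))_{t\in I}$ be a strongly continuous family of bounded self-adjoint operators on $\mathcal H$ with $\sup_{t\in I}\|B(t)\|<\infty$. Let $H^1(I,\mathcal H)$ be the space of all $w\in L^2(I,\mathcal H)$ with weak derivative $\partial_t w\in L^2(I,\mathcal H)$, each $w$ being identified with its representative that is continuous on $[0,T]$. For $\Sigma\subset\mathcal H$ let $H^1(I,\Sigma)=\{w\in H^1(I,\mathcal H): w(t)\in\Sigma\text{ for every }t\in I\}$. For $w\in H^1(I,\mathcal H)$ let $$F(w)=\|w(0)-u_0\|_{\mathcal H}^2+T\,\big\|\big(i\partial_t-e^{itH_0}(W+B(t))e^{-itH_0}\big)w\big\|_{L^2(I,\mathcal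 H)}^2 .$$ This is well defined: for every $w\in H^1(I,\mathcal H)$ one has $e^{-itH_0}w(t)\in D(W)$ for almost every $t\in I$, and the function $t\mapsto i\partial_t w(t)-e^{itH_0}(W+B(t))e^{-itH_0}w(t)$ belongs to $L^2(I,\mathcal H)$. Then for every nonempty weakly closed subset $\Sigma\subset\mathcal H$, the functional $F$ has at least one minimizer on $H^1(I,\Sigma)$: there is $\widetilde v\in H^1(I,\Sigma)$ with $F(\widetilde v)\le F(w)$ for all $w\in H^1(I,\Sigma)$. -/

import Mathlib

open MeasureTheory Set Filter Topology
open scoped ENNReal ContDiff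

noncomputable section

namespace SchrodingerLS

variable {H : Type*} [NormedAddCommGroup H] [InnerProductSpace ℂ H] [CompleteSpace H]

/-! ### Unbounded operators -/

/-- `R` is the bounded inverse `(A - z)⁻¹` of the unbounded operator `A - z`. -/
def IsResolvent (A : H →ₗ.[ℂ] H) (z : ℂ) (R : H →L[ℂ] H) : Prop :=
  (∀ x : H, ∃ hx : R x ∈ A.domain, A ⟨R x, hx⟩ - z • R x = x) ∧
    ∀ y : A.domain, R (A y - z • (y : H)) = y

open Classical in
/-- The resolvent `(A - z)⁻¹`, with value `0` when `z` is not in the resolvent set of `A`. -/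
def resolvent (A : H →ₗ.[ℂ] H) (z : ℂ) : H →L[ℂ] H :=
  if h : ∃ R, IsResolvent A z R then h.choose else 0

/-- The bounded (Yosida) approximation
`n² A (A² + n²)⁻¹ = (n² / 2) ((A - i n)⁻¹ + (A + i n)⁻¹)` of a self-adjoint operator `A`. -/
def yosida (A : H →ₗ.[ℂ] H) (n : ℕ) : H →L[ℂ] H :=
  ((n : ℂ) ^ 2 / 2) •
    (resolvent A ((n : ℂ) * Complex.I) + resolvent A (-((n : ℂ) * Complex.I)))

/-- The unitary group `t ↦ e^{itA}` generated by the self-adjoint operator `A`: it is the strong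
limit of the exponentials `e^{it Aₙ}` of the bounded approximations `Aₙ` of `A`. -/
def expI (A : H →ₗ.[ℂ] H) (t : ℝ) (x : H) : H :=
  limUnder atTop fun n : ℕ => NormedSpace.exp (((t : ℂ) * Complex.I) • yosida A n) x

open Classical in
/-- The value `W x`, extended by `0` outside the domain of `W`. -/
def evalOp (W : H →ₗ.[ℂ] H) (x : H) : H :=
  if h : x ∈ W.domain then W ⟨x, h⟩ else 0

/-- The operator norm `sup {‖S x‖ : ‖x‖ ≤ 1}` with values in `[0, ∞]`. -/
def opENorm (S : H → H) : ℝ≥0∞ :=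
  ⨆ x ∈ Metric.closedBall (0 : H) 1, ‖S x‖ₑ

/-- There is `ε > 0` such that `sup_{λ ∈ ℝ} ‖W (H₀ - λ ± iε)⁻¹‖ < 1` for both signs. -/
def IsSmallPerturbation (W H₀ : H →ₗ.[ℂ] H) : Prop :=
  ∃ ε : ℝ, 0 < ε ∧
    (⨆ l : ℝ, opENorm fun x => evalOp W (resolvent H₀ (l - ε * Complex.I) x)) < 1 ∧
    (⨆ l : ℝ, opENorm fun x => evalOp W (resolvent H₀ (l + ε * Complex.I) x)) < 1

/-! ### The Sobolev space `H¹(I, H)` on `I = (0, T)` -/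

/-- Lebesgue measure on `I = (0, T)`. -/
abbrev volI (T : ℝ) : Measure ℝ := volume.restrict (Ioo 0 T)

/-- `g` is the weak derivative of `w` on `I = (0, T)`. -/
def IsWeakDeriv (T : ℝ) (w g : ℝ → H) : Prop :=
  ∀ φ : ℝ → ℝ, ContDiff ℝ ∞ φ → HasCompactSupport φ → tsupport φ ⊆ Ioo 0 T →
    ∫ t, deriv φ t • w t ∂(volI T) = -∫ t, φ t • g t ∂(volI T)

/-- `w ∈ H¹(I, H)`: `w` is in `L²` with a weak derivative in `L²`. Every class in `H¹(I, H)`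
contains exactly one function that is continuous on `[0, T]`, by which it is represented here;
the values of `w` outside `[0, T]` play no role. -/
def MemH1 (T : ℝ) (w : ℝ → H) : Prop :=
  MemLp w 2 (volI T) ∧ (∃ g : ℝ → H, MemLp g 2 (volI T) ∧ IsWeakDeriv T w g) ∧
    ContinuousOn w (Icc 0 T)

open Classical in
/-- The weak derivative `∂ₜ w ∈ L²(I, H)` of `w ∈ H¹(I, H)` (unique up to null sets). -/
def weakDeriv (T : ℝ) (w : ℝ → H) : ℝ → H :=
  if h : ∃ g : ℝ → H, MemLp g 2 (volI T) ∧ IsWeakDeriv T w g then h.choose else 0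

/-- `H¹(I, S) = {w ∈ H¹(I, H) : w(t) ∈ S for every t ∈ I}`. -/
def H1Set (T : ℝ) (S : Set H) : Set (ℝ → H) :=
  {w | MemH1 T w ∧ ∀ t ∈ Ioo 0 T, w t ∈ S}

/-! ### The least-squares functional -/

/-- The residual `i ∂ₜ w(t) - e^{itH₀} (W + B(t)) e^{-itH₀} w(t)`. -/
def residual (T : ℝ) (H₀ W : H →ₗ.[ℂ] H) (B : ℝ → H →L[ℂ] H) (w : ℝ → H) (t : ℝ) : H :=
  Complex.I • weakDeriv T w t -
    expI H₀ t (evalOp W (expI H₀ (-t) (w t)) + B t (expI H₀ (-t) (w t)))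

/-- The functional
`F(w) = ‖w(0) - u₀‖² + T ‖(i ∂ₜ - e^{itH₀} (W + B(t)) e^{-itH₀}) w‖²_{L²(I, H)}`. -/
def lsFunctional (T : ℝ) (H₀ W : H →ₗ.[ℂ] H) (B : ℝ → H →L[ℂ] H) (u₀ : H) (w : ℝ → H) : ℝ :=
  ‖w 0 - u₀‖ ^ 2 + T * ∫ t, ‖residual T H₀ W B w t‖ ^ 2 ∂(volI T)

end SchrodingerLS

end

open scoped InnerProductSpace InnerProduct FourierTransform

noncomputable section

namespace SchrodingerLS

variable {H : Type*} [NormedAddCommGroup H] [InnerProductSpace ℂ H] [CompleteSpace H]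

/-! ### Resolvents of self-adjoint operators -/

section SelfAdjoint

variable {A : H →ₗ.[ℂ] H} (hA : IsSelfAdjoint A)

include hA

/-! A path in `H¹(I, H)` is `w₀ + ∫₀ᵗ g` for exactly one pair `(w₀, g)` in the Hilbert space `H ×
L²(I, H)`. In these coordinates the functional is `‖w₀ - u₀‖² + T ‖L(w₀, g)‖²`, where the residual
`L` is linear. If `L` is bounded, the functional is convex and continuous, hence weakly lower
semicontinuous; if it is also coercive, its sublevel sets lie in weakly compact balls. Evaluation at
a fixed time is bounded, so the constraint `w(t) ∈ S` cuts out a weakly closed set, and a minimizer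
exists (`exists_isMinOn_of_coercive`, `isClosed_paths`). What remains are two estimates on `L`.

Boundedness is a smoothing property of `W` along the free evolution. Extend the path to the line so
that it vanishes before time `-1`, and write `u(t) = e^{-itA} ∫_{s<t} g`. The Fourier transform of
`e^{-εt} u(t)` at `ξ` is `-i (A - z)⁻¹`, with `z = -2πξ + iε`, applied to that of `e^{-εt} e^{-itA}
g(t)` (`fourier_duhamel`). By Plancherel, the bound `‖W (A - l - iε)⁻¹‖ ≤ c` becomes `‖e^{-εt} W u‖
≤ c ‖e^{-εt} g‖` in `L²` (`evalOp_duhamel`, `evalOp_prim`). Since `W` is unbounded, the argument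
runs with the bounded operators `W Jₙ`, where the `Jₙ` are resolvent contractions tending strongly
to the identity, and closedness of `W` gives the limit.

Coercivity uses `c < 1`. Solving the residual for `i g` and taking the weighted norm, the `W` term
is at most `c` times the norm of `g`, up to a multiple of `‖w₀‖`, and is absorbed on the left. The
`B` term need not be small, but it is controlled by `sup ‖w(t)‖`. Symmetry of `W` and `B` gives
`d/dt ‖w‖² ≤ 2 ‖w‖ ‖r‖` for the residual `r`, so this supremum is at most `‖w₀‖ + 2 √T ‖r‖`
(`norm_evalPath_le`, `exists_norm_le`). -/

lemma inner_apply_comm (x y : A.domain) : ⟪A x, (y : H)⟫_ℂ = ⟪(x : H), A y⟫_ℂ := by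
  have h := LinearPMap.adjoint_isFormalAdjoint (T := A) hA.dense_domain
  rw [LinearPMap.isSelfAdjoint_def.1 hA] at h
  exact h x y

/-- This is the half of `A* = A` that goes beyond symmetry: the domain is as large as that of the
adjoint. -/
lemma exists_mem_domain_of_inner {y w : H} (h : ∀ x : A.domain, ⟪w, (x : H)⟫_ℂ = ⟪y, A x⟫_ℂ) :
    ∃ hy : y ∈ A.domain, A ⟨y, hy⟩ = w := by
  have h' : ∃ hy : y ∈ (LinearPMap.adjoint A).domain, LinearPMap.adjoint A ⟨y, hy⟩ = w :=
    ⟨LinearPMap.mem_adjoint_domain_of_exists y ⟨w, h⟩,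
      LinearPMap.adjoint_apply_eq hA.dense_domain _ h⟩
  rwa [LinearPMap.isSelfAdjoint_def.1 hA] at h'

/-- The number `⟪x, A x⟫` is real, so the imaginary part of `⟪x, (A - z) x⟫` is `-(Im z) ‖x‖²`;
apply Cauchy–Schwarz. -/
lemma abs_im_mul_norm_le (z : ℂ) (x : A.domain) :
    |z.im| * ‖(x : H)‖ ≤ ‖A x - z • (x : H)‖ := by
  have h1 : (⟪(x : H), A x⟫_ℂ).im = 0 := by
    have h2 := inner_apply_comm hA x x
    rw [← inner_conj_symm] at h2
    exact Complex.conj_eq_iff_im.1 h2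
  have h3 : (⟪(x : H), A x - z • (x : H)⟫_ℂ).im = -(z.im * ‖(x : H)‖ ^ 2) := by
    rw [inner_sub_right, inner_smul_right, inner_self_eq_norm_sq_to_K, Complex.sub_im, h1]
    simp [← Complex.ofReal_pow]
  have h4 : |z.im| * ‖(x : H)‖ ^ 2 ≤ ‖(x : H)‖ * ‖A x - z • (x : H)‖ := by
    calc |z.im| * ‖(x : H)‖ ^ 2 = |(⟪(x : H), A x - z • (x : H)⟫_ℂ).im| := by
          rw [h3, abs_neg, abs_mul, abs_of_nonneg (sq_nonneg ‖(x : H)‖)]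
      _ ≤ ‖⟪(x : H), A x - z • (x : H)⟫_ℂ‖ := Complex.abs_im_le_norm _
      _ ≤ _ := norm_inner_le_norm _ _
  rcases (norm_nonneg (x : H)).eq_or_lt with h | h
  · rw [← h]; simp
  · exact le_of_mul_le_mul_left (by linarith) h

/-- The lower bound on `A - z` gives injectivity, closed range and a bounded inverse; the same bound
at the conjugate of `z` shows that the range is dense. -/
lemma exists_isResolvent {z : ℂ} (hz : z.im ≠ 0) : ∃ R, IsResolvent A z R := by
  have hz' : 0 < |z.im| := abs_pos.2 hz
  let S : A.domain →ₗ[ℂ] H := A.toFun - z • A.domain.subtype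
  have hS : ∀ x : A.domain, S x = A x - z • (x : H) := fun x => rfl
  have hinj : Function.Injective S := by
    rw [injective_iff_map_eq_zero]
    intro x hx
    have h := abs_im_mul_norm_le hA z x
    rw [← hS, hx, norm_zero] at h
    have : ‖(x : H)‖ = 0 := le_antisymm (nonpos_of_mul_nonpos_right h hz') (norm_nonneg _)
    exact Subtype.ext (norm_eq_zero.1 this)
  -- The graph of `A` is complete, and `(x, A x) ↦ A x - z x` is bounded below for the graph norm,
  -- so its range is closed.
  have hclosed : _root_.IsClosed (S.range : Set H) := by
    have hg : _root_.IsClosed (A.graph : Set (H × H)) := hA.isClosed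
    have : CompleteSpace A.graph := hg.completeSpace_coe
    let G : A.graph → H := fun p => p.1.2 - z • p.1.1
    have hGc : UniformContinuous G :=
      (uniformContinuous_snd.comp uniformContinuous_subtype_val).sub
        ((uniformContinuous_fst.comp uniformContinuous_subtype_val).const_smul z)
    have hmem : ∀ p : A.graph, ∃ x : A.domain, p.1 = ((x : H), A x) := by
      intro p
      obtain ⟨x, hx1, hx2⟩ := (LinearPMap.mem_graph_iff A).1 p.2
      exact ⟨x, Prod.ext hx1.symm hx2.symm⟩
    have hGa : AntilipschitzWith (1 + ‖z‖₊ * (Real.nnabs z.im)⁻¹ + (Real.nnabs z.im)⁻¹) G := by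
      have hb : ∀ p : A.graph, ‖p‖ ≤ (1 + ‖z‖ * |z.im|⁻¹ + |z.im|⁻¹) * ‖G p‖ := by
        intro p
        obtain ⟨x, hx⟩ := hmem p
        have h1 := abs_im_mul_norm_le hA z x
        have h2 : ‖(x : H)‖ ≤ |z.im|⁻¹ * ‖A x - z • (x : H)‖ := by
          rw [inv_mul_eq_div, le_div_iff₀ hz']; linarith
        have h3 : ‖A x‖ ≤ ‖A x - z • (x : H)‖ + ‖z‖ * ‖(x : H)‖ := by
          calc ‖A x‖ = ‖(A x - z • (x : H)) + z • (x : H)‖ := by rw [sub_add_cancel]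
            _ ≤ _ := (norm_add_le _ _).trans_eq (by rw [norm_smul])
        have h4 : G p = A x - z • (x : H) := by simp only [G, hx]
        have h5 : ‖p‖ = max ‖(x : H)‖ ‖A x‖ := by
          change ‖(p : H × H)‖ = _
          rw [hx]; rfl
        have h6 : 0 ≤ |z.im|⁻¹ * ‖A x - z • (x : H)‖ := by positivity
        have h7 := mul_le_mul_of_nonneg_left h2 (norm_nonneg z)
        have h8 := mul_nonneg (norm_nonneg z) h6
        have h9 := norm_nonneg (A x - z • (x : H))
        rw [h4, h5]
        apply max_le <;> nlinarith
      refine AntilipschitzWith.of_le_mul_dist fun p q => ?_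
      have h := hb (p - q)
      have h' : G (p - q) = G p - G q := by
        simp only [G, Submodule.coe_sub, Prod.fst_sub, Prod.snd_sub, smul_sub]; abel
      rw [dist_eq_norm, dist_eq_norm, ← h']
      simpa using h
    have hr := hGa.isClosed_range hGc
    convert hr using 1
    ext y
    constructor
    · rintro ⟨x, rfl⟩
      exact ⟨⟨((x : H), A x), A.mem_graph x⟩, rfl⟩
    · rintro ⟨p, rfl⟩
      obtain ⟨x, hx⟩ := hmem p
      exact ⟨x, by simp only [G, hx, hS]⟩
  -- A vector orthogonal to the range lies in the domain of `A* = A` and is an eigenvector for the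
  -- non-real number `conj z`, so it vanishes.
  have hdense : S.rangeᗮ = ⊥ := by
    rw [Submodule.eq_bot_iff]
    intro y hy
    have hy' : ∀ x : A.domain, ⟪A x - z • (x : H), y⟫_ℂ = 0 := fun x => hy _ ⟨x, rfl⟩
    obtain ⟨hyd, hyA⟩ := exists_mem_domain_of_inner hA (y := y) (w := (starRingEnd ℂ z) • y)
      (fun x => by
        have h := hy' x
        rw [inner_sub_left, inner_smul_left, sub_eq_zero] at h
        rw [inner_smul_left, Complex.conj_conj, ← inner_conj_symm y (A x), h, map_mul,
          Complex.conj_conj, inner_conj_symm])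
    have h := abs_im_mul_norm_le hA (starRingEnd ℂ z) ⟨y, hyd⟩
    rw [hyA, sub_self, norm_zero, Complex.conj_im, abs_neg] at h
    exact norm_eq_zero.1 (le_antisymm (nonpos_of_mul_nonpos_right h hz') (norm_nonneg _))
  have hsurj : Function.Surjective S := by
    rw [← LinearMap.range_eq_top]
    have h := (Submodule.topologicalClosure_eq_top_iff (K := S.range)).2 hdense
    rwa [hclosed.submodule_topologicalClosure_eq] at h
  let e := LinearEquiv.ofBijective S ⟨hinj, hsurj⟩
  have he : ∀ x, S (e.symm x) = x := fun x => e.apply_symm_apply x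
  let R : H →L[ℂ] H := (A.domain.subtype ∘ₗ e.symm.toLinearMap).mkContinuous |z.im|⁻¹ (by
    intro x
    have h := abs_im_mul_norm_le hA z (e.symm x)
    rw [← hS, he] at h
    rw [inv_mul_eq_div, le_div_iff₀ hz', mul_comm]
    exact h)
  refine ⟨R, fun x => ⟨(e.symm x).2, ?_⟩, fun y => ?_⟩
  · exact he x
  · have : e.symm (A y - z • (y : H)) = y := by
      rw [← hS]; exact e.symm_apply_apply y
    exact congrArg Subtype.val this

lemma resolvent_spec {z : ℂ} (hz : z.im ≠ 0) : IsResolvent A z (resolvent A z) := by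
  have h := exists_isResolvent hA hz
  rw [resolvent, dif_pos h]
  exact h.choose_spec

lemma resolvent_mem {z : ℂ} (hz : z.im ≠ 0) (x : H) : resolvent A z x ∈ A.domain :=
  ((resolvent_spec hA hz).1 x).1

lemma apply_resolvent {z : ℂ} (hz : z.im ≠ 0) (x : H) :
    A ⟨resolvent A z x, resolvent_mem hA hz x⟩ = x + z • resolvent A z x :=
  sub_eq_iff_eq_add.1 ((resolvent_spec hA hz).1 x).2

lemma resolvent_apply {z : ℂ} (hz : z.im ≠ 0) (y : A.domain) :
    resolvent A z (A y) = y + z • resolvent A z y := by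
  have h := (resolvent_spec hA hz).2 y
  rwa [map_sub, map_smul, sub_eq_iff_eq_add] at h

lemma norm_resolvent_apply_le {z : ℂ} (hz : z.im ≠ 0) (x : H) :
    ‖resolvent A z x‖ ≤ |z.im|⁻¹ * ‖x‖ := by
  have h := abs_im_mul_norm_le hA z ⟨resolvent A z x, resolvent_mem hA hz x⟩
  rw [apply_resolvent hA hz, add_sub_cancel_right] at h
  rw [inv_mul_eq_div, le_div_iff₀ (abs_pos.2 hz), mul_comm]
  exact h

lemma inner_resolvent {z : ℂ} (hz : z.im ≠ 0) (x y : H) :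
    ⟪resolvent A z x, y⟫_ℂ = ⟪x, resolvent A (starRingEnd ℂ z) y⟫_ℂ := by
  have hz' : (starRingEnd ℂ z).im ≠ 0 := by simpa using hz
  have h := inner_apply_comm hA ⟨_, resolvent_mem hA hz x⟩ ⟨_, resolvent_mem hA hz' y⟩
  rw [apply_resolvent hA hz, apply_resolvent hA hz', inner_add_left, inner_add_right,
    inner_smul_left, inner_smul_right] at h
  exact (add_right_cancel h).symm

lemma adjoint_resolvent {z : ℂ} (hz : z.im ≠ 0) :
    star (resolvent A z) = resolvent A (starRingEnd ℂ z) := by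
  rw [ContinuousLinearMap.star_eq_adjoint]
  symm
  rw [ContinuousLinearMap.eq_adjoint_iff]
  intro x y
  have hz' : (starRingEnd ℂ z).im ≠ 0 := by simpa using hz
  rw [inner_resolvent hA hz', Complex.conj_conj]

/-- In the resolvent identity `R(z) - R(w) = (z - w) R(z) R(w)`, exchanging `z` and `w` changes the
sign of the left side, which forces the two products to agree. -/
lemma commute_resolvent {z w : ℂ} (hz : z.im ≠ 0) (hw : w.im ≠ 0) :
    Commute (resolvent A z) (resolvent A w) := by
  have key : ∀ {z w : ℂ}, z.im ≠ 0 → w.im ≠ 0 → ∀ x, resolvent A z x - resolvent A w x =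
      (z - w) • resolvent A z (resolvent A w x) := by
    intro z w hz hw x
    have h := resolvent_apply hA hz ⟨_, resolvent_mem hA hw x⟩
    rw [apply_resolvent hA hw, map_add, map_smul] at h
    rw [sub_smul, eq_sub_of_add_eq h]
    abel
  rcases eq_or_ne z w with rfl | hne
  · exact Commute.refl _
  · ext x
    have h1 := key hz hw x
    have h2 := key hw hz x
    have h3 : (z - w) • resolvent A z (resolvent A w x) =
        (z - w) • resolvent A w (resolvent A z x) := by
      rw [← h1, ← neg_sub w z, neg_smul, ← h2, neg_sub]
    exact smul_right_injective H (sub_ne_zero.2 hne) h3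

end SelfAdjoint

/-! ### The unitary group of a bounded self-adjoint operator -/

/-- The unitary group `t ↦ e^{itS}` generated by a bounded operator `S`. -/
def expB (S : H →L[ℂ] H) (t : ℝ) : H →L[ℂ] H := NormedSpace.exp (((t : ℂ) * Complex.I) • S)

lemma expB_zero (S : H →L[ℂ] H) : expB S 0 = 1 := by simp [expB]

lemma expB_add (S : H →L[ℂ] H) (s t : ℝ) : expB S (s + t) = expB S s * expB S t := by
  let +nondep : NormedAlgebra ℚ (H →L[ℂ] H) := .restrictScalars ℚ ℂ _
  rw [expB, expB, expB, ← NormedSpace.exp_add_of_commute, ← add_smul]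
  · push_cast; ring_nf
  · exact ((Commute.refl S).smul_left _).smul_right _

lemma expB_commute {S S' : H →L[ℂ] H} (h : Commute S S') (t : ℝ) : Commute S (expB S' t) :=
  (h.smul_right _).exp_right

lemma expB_sub {S S' : H →L[ℂ] H} (h : Commute S S') (t : ℝ) :
    expB S t = expB S' t * expB (S - S') t := by
  let +nondep : NormedAlgebra ℚ (H →L[ℂ] H) := .restrictScalars ℚ ℂ _
  rw [expB, expB, expB, ← NormedSpace.exp_add_of_commute, ← smul_add, add_sub_cancel]
  exact ((h.symm.sub_right (Commute.refl S')).smul_left _).smul_right _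

lemma expB_mem_unitary {S : H →L[ℂ] H} (hS : IsSelfAdjoint S) (t : ℝ) :
    expB S t ∈ unitary (H →L[ℂ] H) := by
  let +nondep : NormedAlgebra ℚ (H →L[ℂ] H) := .restrictScalars ℚ ℂ _
  refine NormedSpace.exp_mem_unitary_of_mem_skewAdjoint ?_
  apply hS.smul_mem_skewAdjoint
  simp [skewAdjoint.mem_iff]

lemma norm_expB_apply {S : H →L[ℂ] H} (hS : IsSelfAdjoint S) (t : ℝ) (x : H) :
    ‖expB S t x‖ = ‖x‖ :=
  ContinuousLinearMap.norm_map_of_mem_unitary (expB_mem_unitary hS t) x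

lemma hasDerivAt_expB (S : H →L[ℂ] H) (x : H) (t : ℝ) :
    HasDerivAt (fun s => expB S s x) (Complex.I • expB S t (S x)) t := by
  have h := (hasDerivAt_exp_smul_const (𝕂 := ℝ) (Complex.I • S) t)
  have h2 := ((ContinuousLinearMap.apply ℂ H x).restrictScalars ℝ).hasFDerivAt.comp_hasDerivAt t h
  have h3 : ∀ s : ℝ, NormedSpace.exp (s • Complex.I • S) = expB S s := by
    intro s
    rw [expB, mul_smul, Complex.coe_smul]
  simp only [Function.comp_def, ContinuousLinearMap.coe_restrictScalars', h3] at h2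
  simpa using h2

/-- The derivative `i e^{isS} S x` has constant norm `‖S x‖`; use the mean value inequality. -/
lemma norm_expB_sub_le {S : H →L[ℂ] H} (hS : IsSelfAdjoint S) (t : ℝ) (x : H) :
    ‖expB S t x - x‖ ≤ |t| * ‖S x‖ := by
  have h := Convex.norm_image_sub_le_of_norm_hasDerivWithin_le (s := univ) (x := 0) (y := t)
    (C := ‖S x‖) (fun s _ => (hasDerivAt_expB S x s).hasDerivWithinAt)
    (fun s _ => by rw [norm_smul, Complex.norm_I, one_mul, norm_expB_apply hS]) convex_univ
    (mem_univ _) (mem_univ _)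
  simpa [expB_zero, mul_comm] using h

/-- By commutation `e^{itS} = e^{itS'} e^{it(S - S')}`, and the first factor is unitary. This turns
strong convergence of the generators into convergence of the groups. -/
lemma norm_expB_sub_expB_le {S S' : H →L[ℂ] H} (hS : IsSelfAdjoint S) (hS' : IsSelfAdjoint S')
    (h : Commute S S') (t : ℝ) (x : H) :
    ‖expB S t x - expB S' t x‖ ≤ |t| * ‖S x - S' x‖ := by
  rw [expB_sub h, mul_apply_eq_comp, ← map_sub, norm_expB_apply hS']
  exact norm_expB_sub_le (hS.sub hS') t x

/-! ### The unitary group of an unbounded self-adjoint operator -/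

section SelfAdjoint

variable {A : H →ₗ.[ℂ] H} (hA : IsSelfAdjoint A)

include hA

/-- The approximation `z (A - z)⁻¹ → -1` along the imaginary axis, on the domain of `A`. -/
lemma norm_resolvent_add_le {z : ℂ} (hz : z.im ≠ 0) (x : A.domain) :
    ‖z • resolvent A z x + x‖ ≤ |z.im|⁻¹ * ‖A x‖ := by
  rw [add_comm, ← resolvent_apply hA hz]
  exact norm_resolvent_apply_le hA hz _

omit hA [CompleteSpace H] in
lemma natCast_mul_I_im_ne {n : ℕ} (hn : n ≠ 0) : ((n : ℂ) * Complex.I).im ≠ 0 := by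
  simpa using hn

omit hA [CompleteSpace H] in
lemma neg_natCast_mul_I_im_ne {n : ℕ} (hn : n ≠ 0) : (-((n : ℂ) * Complex.I)).im ≠ 0 := by
  simpa using hn

/-! ### Yosida approximations and mollifiers. -/

lemma isSelfAdjoint_yosida (n : ℕ) : IsSelfAdjoint (yosida A n) := by
  rcases eq_or_ne n 0 with rfl | hn
  · simp [yosida]
  · rw [yosida, isSelfAdjoint_iff, star_smul, star_add,
      adjoint_resolvent hA (natCast_mul_I_im_ne hn),
      adjoint_resolvent hA (neg_natCast_mul_I_im_ne hn)]
    simp [add_comm]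

lemma commute_resolvent_yosida {z : ℂ} (hz : z.im ≠ 0) (n : ℕ) :
    Commute (resolvent A z) (yosida A n) := by
  rcases eq_or_ne n 0 with rfl | hn
  · simp [yosida]
  · exact ((commute_resolvent hA hz (natCast_mul_I_im_ne hn)).add_right
      (commute_resolvent hA hz (neg_natCast_mul_I_im_ne hn))).smul_right _

lemma commute_yosida (m n : ℕ) : Commute (yosida A m) (yosida A n) := by
  rcases eq_or_ne m 0 with rfl | hm
  · simp [yosida]
  · exact ((commute_resolvent_yosida hA (natCast_mul_I_im_ne hm) n).add_left
      (commute_resolvent_yosida hA (neg_natCast_mul_I_im_ne hm) n)).smul_left _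

/-- The contractions `-i(n+1) (A - i(n+1))⁻¹` approximating the identity. -/
def mollifier (A : H →ₗ.[ℂ] H) (n : ℕ) : H →L[ℂ] H :=
  (-(((n + 1 : ℕ) : ℂ) * Complex.I)) • resolvent A (((n + 1 : ℕ) : ℂ) * Complex.I)

lemma norm_smul_resolvent_apply_le {n : ℕ} (hn : n ≠ 0) {z : ℂ}
    (hz : z = (n : ℂ) * Complex.I ∨ z = -((n : ℂ) * Complex.I)) (x : H) :
    ‖z • resolvent A z x‖ ≤ ‖x‖ := by
  have h1 : |z.im| = n := by rcases hz with rfl | rfl <;> simp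
  have h2 : ‖z‖ = n := by rcases hz with rfl | rfl <;> simp
  have h0 : (0 : ℝ) < n := by positivity
  have hz0 : z.im ≠ 0 := by rw [← abs_pos, h1]; exact h0
  rw [norm_smul, h2]
  calc (n : ℝ) * ‖resolvent A z x‖ ≤ n * ((n : ℝ)⁻¹ * ‖x‖) := by
        gcongr; exact h1 ▸ norm_resolvent_apply_le hA hz0 x
    _ = ‖x‖ := by field_simp

omit hA [CompleteSpace H] in
/-- A uniformly bounded sequence of operators that converges to zero on a dense set converges to
zero strongly. -/
lemma tendsto_of_dense {S : ℕ → H →L[ℂ] H} {D : Set H} (hD : Dense D) (C : ℝ)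
    (hC : ∀ n x, ‖S n x‖ ≤ C * ‖x‖) (h : ∀ x ∈ D, Tendsto (fun n => S n x) atTop (𝓝 0)) (x : H) :
    Tendsto (fun n => S n x) atTop (𝓝 0) := by
  rw [Metric.tendsto_atTop]
  intro ε hε
  have hC0 : 0 < |C| + 1 := by positivity
  obtain ⟨y, hy, hxy⟩ := hD.exists_dist_lt x (ε := ε / 2 / (|C| + 1)) (by positivity)
  obtain ⟨N, hN⟩ := Metric.tendsto_atTop.1 (h y hy) (ε / 2) (by positivity)
  refine ⟨N, fun n hn => ?_⟩
  have h1 := hN n hn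
  rw [dist_zero_right] at h1 ⊢
  have h2 : ‖S n (x - y)‖ ≤ ε / 2 := by
    calc ‖S n (x - y)‖ ≤ C * ‖x - y‖ := hC _ _
      _ ≤ (|C| + 1) * ‖x - y‖ := by gcongr; linarith [le_abs_self C]
      _ ≤ (|C| + 1) * (ε / 2 / (|C| + 1)) := by rw [← dist_eq_norm]; gcongr
      _ = ε / 2 := by field_simp
  calc ‖S n x‖ = ‖S n (x - y) + S n y‖ := by rw [← map_add, sub_add_cancel]
    _ ≤ ‖S n (x - y)‖ + ‖S n y‖ := norm_add_le _ _
    _ < ε := by linarith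

/-- On the domain the error is at most `‖A x‖ / (n + 1)`; the uniform bound `2 ‖x‖` extends the
convergence to all vectors by density. -/
lemma tendsto_smul_resolvent {z : ℕ → ℂ}
    (hz : ∀ n : ℕ, z n = ((n + 1 : ℕ) : ℂ) * Complex.I ∨ z n = -(((n + 1 : ℕ) : ℂ) * Complex.I))
    (x : H) : Tendsto (fun n => z n • resolvent A (z n) x + x) atTop (𝓝 0) := by
  refine tendsto_of_dense (S := fun n => z n • resolvent A (z n) + 1) hA.dense_domain 2 ?_ ?_ x
  · intro n x
    have h := norm_smul_resolvent_apply_le hA (Nat.succ_ne_zero n) (hz n) x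
    calc _ ≤ ‖z n • resolvent A (z n) x‖ + ‖x‖ := norm_add_le _ _
      _ ≤ 2 * ‖x‖ := by linarith
  · intro x hx
    have h1 : ∀ n, |(z n).im| = (n + 1 : ℝ) := by
      intro n
      have h0 : |(((n + 1 : ℕ) : ℂ) * Complex.I).im| = (n + 1 : ℝ) := by
        rw [Complex.mul_I_im, Complex.natCast_re, Nat.abs_cast, Nat.cast_succ]
      rcases hz n with h | h
      · rw [h, h0]
      · rw [h, Complex.neg_im, abs_neg, h0]
    refine squeeze_zero_norm (a := fun n : ℕ => (1 / ((n : ℝ) + 1)) * ‖A ⟨x, hx⟩‖) (fun n => ?_) ?_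
    · have h := norm_resolvent_add_le hA (z := z n)
        (by rw [← abs_pos, h1]; positivity) ⟨x, hx⟩
      rw [h1, ← one_div] at h
      exact h
    · simpa using (tendsto_one_div_add_atTop_nhds_zero_nat (𝕜 := ℝ)).mul_const ‖A ⟨x, hx⟩‖

lemma tendsto_mollifier (x : H) : Tendsto (fun n => mollifier A n x) atTop (𝓝 x) := by
  have h := tendsto_smul_resolvent hA
    (z := fun n => ((n + 1 : ℕ) : ℂ) * Complex.I) (fun n => Or.inl rfl) x
  have h2 := h.const_sub x
  rw [sub_zero] at h2
  refine h2.congr fun n => ?_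
  rw [mollifier, neg_smul, neg_apply, smul_apply]
  abel

lemma norm_mollifier_apply_le (n : ℕ) (x : H) : ‖mollifier A n x‖ ≤ ‖x‖ := by
  have h := norm_smul_resolvent_apply_le hA (Nat.succ_ne_zero n) (Or.inl rfl) x
  rw [mollifier, neg_smul, neg_apply, norm_neg]
  exact h

lemma mollifier_mem (n : ℕ) (x : H) : mollifier A n x ∈ A.domain :=
  A.domain.smul_mem _ (resolvent_mem hA (natCast_mul_I_im_ne (Nat.succ_ne_zero n)) x)

lemma commute_resolvent_mollifier {z : ℂ} (hz : z.im ≠ 0) (n : ℕ) :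
    Commute (resolvent A z) (mollifier A n) :=
  (commute_resolvent hA hz (natCast_mul_I_im_ne (Nat.succ_ne_zero n))).smul_right _

/-- On the domain, `-z R(z) A x = -z x - z² R(z) x`. Averaging over `z = ±i n` cancels the linear
terms and leaves the Yosida approximation, while each term tends to `A x`. -/
lemma tendsto_yosida (x : A.domain) :
    Tendsto (fun n => yosida A n x) atTop (𝓝 (A x)) := by
  -- The index is shifted because `n = 0` would call for a resolvent at the real point `0`.
  rw [← tendsto_add_atTop_iff_nat 1]
  have h1 := tendsto_smul_resolvent hA
    (z := fun n => ((n + 1 : ℕ) : ℂ) * Complex.I) (fun n => Or.inl rfl) (A x)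
  have h2 := tendsto_smul_resolvent hA
    (z := fun n => -(((n + 1 : ℕ) : ℂ) * Complex.I)) (fun n => Or.inr rfl) (A x)
  have h3 := ((h1.add h2).const_smul (2⁻¹ : ℂ)).const_sub (A x)
  simp only [add_zero, smul_zero, sub_zero] at h3
  refine h3.congr fun n => ?_
  have h4 := resolvent_apply hA (natCast_mul_I_im_ne (Nat.succ_ne_zero n)) x
  have h5 := resolvent_apply hA (neg_natCast_mul_I_im_ne (Nat.succ_ne_zero n)) x
  rw [h4, h5]
  simp only [yosida, smul_apply, add_apply]
  generalize ((n + 1 : ℕ) : ℂ) = c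
  generalize hu : resolvent A (c * Complex.I) (x : H) = u
  generalize resolvent A (-(c * Complex.I)) (x : H) = v
  have hI : Complex.I * Complex.I = -1 := Complex.I_mul_I
  have e1 : (c * Complex.I) • (c * Complex.I) • u = -(c ^ 2) • u := by
    rw [smul_smul]; congr 1; linear_combination c ^ 2 * hI
  have e2 : (-(c * Complex.I)) • (-(c * Complex.I)) • v = -(c ^ 2) • v := by
    rw [smul_smul]; congr 1; linear_combination c ^ 2 * hI
  rw [smul_add (c * Complex.I), smul_add (-(c * Complex.I)), e1, e2]
  module

lemma norm_expB_yosida_sub_le (m n : ℕ) (t : ℝ) (x : H) :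
    ‖expB (yosida A m) t x - expB (yosida A n) t x‖ ≤ |t| * ‖yosida A m x - yosida A n x‖ :=
  norm_expB_sub_expB_le (isSelfAdjoint_yosida hA m) (isSelfAdjoint_yosida hA n)
    (commute_yosida hA m n) t x

/-- For `y` in the domain the groups differ by at most `|t| ‖Aₘ y - Aₙ y‖`; unitarity transfers the
estimate to any `x` close to such a `y`. -/
lemma uniformCauchySeqOn_expB (M : ℝ) (x : H) :
    UniformCauchySeqOn (fun n t => expB (yosida A n) t x) atTop (Icc (-M) M) := by
  rw [Metric.uniformCauchySeqOn_iff]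
  intro ε hε
  obtain ⟨y, hy, hxy⟩ := hA.dense_domain.exists_dist_lt x (ε := ε / 4) (by positivity)
  have hcs := (tendsto_yosida hA ⟨y, hy⟩).cauchySeq
  obtain ⟨N, hN⟩ := Metric.cauchySeq_iff.1 hcs (ε / 4 / (|M| + 1)) (by positivity)
  refine ⟨N, fun m hm n hn t ht => ?_⟩
  have h1 := norm_expB_yosida_sub_le hA m n t y
  have h2 := hN m hm n hn
  rw [dist_eq_norm] at h2 ⊢
  have h3 : |t| ≤ |M| + 1 := by
    have := abs_le.2 ht
    linarith [le_abs_self M]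
  have h4 : ‖expB (yosida A m) t y - expB (yosida A n) t y‖ ≤ ε / 4 := by
    refine h1.trans ?_
    calc |t| * ‖yosida A m y - yosida A n y‖ ≤ (|M| + 1) * (ε / 4 / (|M| + 1)) := by gcongr
      _ = ε / 4 := by field_simp
  have h5 : ∀ k, ‖expB (yosida A k) t x - expB (yosida A k) t y‖ < ε / 4 := by
    intro k
    rw [← map_sub, norm_expB_apply (isSelfAdjoint_yosida hA k), ← dist_eq_norm]
    exact hxy
  have h6 := h5 m
  have h7 := h5 n
  rw [norm_sub_rev] at h7
  calc ‖expB (yosida A m) t x - expB (yosida A n) t x‖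
      = ‖(expB (yosida A m) t x - expB (yosida A m) t y) +
          (expB (yosida A m) t y - expB (yosida A n) t y) +
          (expB (yosida A n) t y - expB (yosida A n) t x)‖ := by congr 1; abel
    _ ≤ _ := norm_add₃_le
    _ < ε := by linarith

lemma tendsto_expI (t : ℝ) (x : H) :
    Tendsto (fun n => expB (yosida A n) t x) atTop (𝓝 (expI A t x)) := by
  have h := uniformCauchySeqOn_expB hA |t| x
  have h2 : CauchySeq fun n => expB (yosida A n) t x :=
    h.cauchySeq ⟨neg_abs_le t, le_abs_self t⟩
  exact h2.tendsto_limUnder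

lemma tendstoUniformlyOn_expI (M : ℝ) (x : H) :
    TendstoUniformlyOn (fun n t => expB (yosida A n) t x) (fun t => expI A t x) atTop
      (Icc (-M) M) :=
  (uniformCauchySeqOn_expB hA M x).tendstoUniformlyOn_of_tendsto
    fun t _ => tendsto_expI hA t x

lemma expI_add_apply (t : ℝ) (x y : H) : expI A t (x + y) = expI A t x + expI A t y := by
  refine tendsto_nhds_unique (tendsto_expI hA t (x + y)) ?_
  simpa only [map_add] using (tendsto_expI hA t x).add (tendsto_expI hA t y)

lemma expI_smul (t : ℝ) (c : ℂ) (x : H) : expI A t (c • x) = c • expI A t x := by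
  refine tendsto_nhds_unique (tendsto_expI hA t (c • x)) ?_
  simpa only [map_smul] using (tendsto_expI hA t x).const_smul c

lemma norm_expI (t : ℝ) (x : H) : ‖expI A t x‖ = ‖x‖ := by
  refine tendsto_nhds_unique (tendsto_expI hA t x).norm ?_
  simp only [norm_expB_apply (isSelfAdjoint_yosida hA _)]
  exact tendsto_const_nhds

lemma expI_zero (x : H) : expI A 0 x = x := by
  refine tendsto_nhds_unique (tendsto_expI hA 0 x) ?_
  simp [expB_zero]

lemma expI_sub (t : ℝ) (x y : H) : expI A t (x - y) = expI A t x - expI A t y := by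
  rw [sub_eq_add_neg, expI_add_apply hA, ← neg_one_smul ℂ y, expI_smul hA]
  simp [sub_eq_add_neg]

lemma expI_add (s t : ℝ) (x : H) : expI A (s + t) x = expI A s (expI A t x) := by
  refine tendsto_nhds_unique (tendsto_expI hA (s + t) x) ?_
  have h := tendsto_expI hA s (expI A t x)
  rw [← add_zero (expI A s _)]
  have h2 : Tendsto (fun n => expB (yosida A n) s (expB (yosida A n) t x - expI A t x)) atTop
      (𝓝 0) := by
    rw [tendsto_zero_iff_norm_tendsto_zero]
    simp only [norm_expB_apply (isSelfAdjoint_yosida hA _)]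
    rw [← tendsto_zero_iff_norm_tendsto_zero]
    exact tendsto_sub_nhds_zero_iff.2 (tendsto_expI hA t x)
  refine (h.add h2).congr fun n => ?_
  rw [← map_add, add_sub_cancel, expB_add, mul_apply_eq_comp]

lemma expI_apply_expI_neg (t : ℝ) (x : H) : expI A t (expI A (-t) x) = x := by
  rw [← expI_add hA, add_neg_cancel, expI_zero hA]

lemma inner_expI (t : ℝ) (x y : H) : ⟪expI A t x, expI A t y⟫_ℂ = ⟪x, y⟫_ℂ := by
  refine tendsto_nhds_unique ((tendsto_expI hA t x).inner (tendsto_expI hA t y)) ?_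
  simp only [ContinuousLinearMap.inner_map_map_of_mem_unitary
    (expB_mem_unitary (isSelfAdjoint_yosida hA _) t)]
  exact tendsto_const_nhds

/-- Commutation passes from the approximate generators to their exponentials and then to the strong
limit. -/
lemma expI_comm {S : H →L[ℂ] H} (hS : ∀ n, Commute S (yosida A n)) (t : ℝ) (x : H) :
    S (expI A t x) = expI A t (S x) := by
  refine tendsto_nhds_unique ((S.continuous.tendsto _).comp (tendsto_expI hA t x)) ?_
  refine (tendsto_expI hA t (S x)).congr fun n => ?_
  exact (congrArg (fun T : H →L[ℂ] H => T x) (expB_commute (hS n) t).eq).symm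

lemma resolvent_expI {z : ℂ} (hz : z.im ≠ 0) (t : ℝ) (x : H) :
    resolvent A z (expI A t x) = expI A t (resolvent A z x) :=
  expI_comm hA (commute_resolvent_yosida hA hz) t x

lemma mollifier_expI (n : ℕ) (t : ℝ) (x : H) :
    mollifier A n (expI A t x) = expI A t (mollifier A n x) :=
  expI_comm hA (fun m => (commute_resolvent_yosida hA
    (natCast_mul_I_im_ne (Nat.succ_ne_zero n)) m).smul_left _) t x

lemma continuous_expI_apply (x : H) : Continuous fun t => expI A t x := by
  rw [continuous_iff_continuousAt]
  intro t
  have h : ContinuousOn (fun t => expI A t x) (Icc (-(|t| + 1)) (|t| + 1)) :=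
    (tendstoUniformlyOn_expI hA (|t| + 1) x).continuousOn (Eventually.of_forall fun n =>
      continuousOn_of_forall_continuousAt fun s _ => (hasDerivAt_expB _ x s).continuousAt).frequently
  exact h.continuousAt (Icc_mem_nhds (by linarith [neg_abs_le t]) (by linarith [le_abs_self t]))

/-- Strong continuity in `t` becomes joint continuity because the operators are isometries. -/
lemma continuous_expI : Continuous fun p : ℝ × H => expI A p.1 p.2 := by
  rw [continuous_iff_continuousAt]
  rintro ⟨t, x⟩
  have h1 : Tendsto (fun p : ℝ × H => expI A p.1 x) (𝓝 (t, x)) (𝓝 (expI A t x)) :=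
    ((continuous_expI_apply hA x).comp continuous_fst).tendsto (t, x)
  have h2 : Tendsto (fun p : ℝ × H => expI A p.1 (p.2 - x)) (𝓝 (t, x)) (𝓝 0) := by
    rw [tendsto_zero_iff_norm_tendsto_zero]
    simp only [norm_expI hA]
    have := ((continuous_snd (X := ℝ) (Y := H)).sub (continuous_const (y := x))).norm.tendsto (t, x)
    simpa using this
  have h3 := h1.add h2
  rw [add_zero] at h3
  refine h3.congr fun p => ?_
  rw [← expI_add_apply hA, add_sub_cancel]

/-- The derivatives `i e^{isAₙ} Aₙ x` converge locally uniformly in `s`, since `Aₙ x → A x` and the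
exponentials are isometric. -/
lemma hasDerivAt_expI (x : A.domain) (t : ℝ) :
    HasDerivAt (fun s => expI A s x) (Complex.I • expI A t (A x)) t := by
  have ht : t ∈ Ioo (-(|t| + 1)) (|t| + 1) :=
    ⟨by linarith [neg_abs_le t], by linarith [le_abs_self t]⟩
  refine hasDerivAt_of_tendstoUniformlyOn (l := atTop) isOpen_Ioo
    (f := fun n s => expB (yosida A n) s x)
    (f' := fun n s => Complex.I • expB (yosida A n) s (yosida A n x))
    (g' := fun s => Complex.I • expI A s (A x)) ?_
    (Eventually.of_forall fun n s _ => hasDerivAt_expB _ _ s)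
    (fun s _ => tendsto_expI hA s x) ht
  rw [Metric.tendstoUniformlyOn_iff]
  intro ε hε
  have h1 := Metric.tendstoUniformlyOn_iff.1 (tendstoUniformlyOn_expI hA (|t| + 1) (A x)) (ε / 2)
    (by positivity)
  have h2 := Metric.tendsto_nhds.1 (tendsto_yosida hA x) (ε / 2) (by positivity)
  filter_upwards [h1, h2] with n h1 h2 s hs
  have h3 := h1 s (Ioo_subset_Icc_self hs)
  rw [dist_eq_norm] at h2 h3 ⊢
  rw [← smul_sub, norm_smul, Complex.norm_I, one_mul]
  calc _ = ‖(expI A s (A x) - expB (yosida A n) s (A x)) -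
        expB (yosida A n) s (yosida A n x - A x)‖ := by rw [map_sub]; congr 1; abel
    _ ≤ _ := norm_sub_le _ _
    _ < ε := by rw [norm_expB_apply (isSelfAdjoint_yosida hA n)]; linarith

end SelfAdjoint

/-! ### Plancherel's theorem for integrable and square-integrable functions -/

lemma integral_fourier_smul_eq {φ : ℝ → ℂ} {f : ℝ → H} (hφ : Integrable φ) (hf : Integrable f) :
    ∫ ξ, (𝓕 φ ξ) • f ξ = ∫ x, φ x • 𝓕 f x := by
  simpa using! (VectorFourier.integral_fourierIntegral_smul_eq_flip (L := innerₗ ℝ)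
    Real.continuous_fourierChar continuous_inner hφ hf)

omit [CompleteSpace H] in
lemma continuous_fourier {f : ℝ → H} (hf : Integrable f) : Continuous (𝓕 f) :=
  VectorFourier.fourierIntegral_continuous Real.continuous_fourierChar
    (by exact continuous_inner) hf

lemma fourier_comp {f : ℝ → H} (hf : Integrable f) (M : H →L[ℂ] H) (ξ : ℝ) :
    𝓕 (fun t => M (f t)) ξ = M (𝓕 f ξ) := by
  simp only [Real.fourier_real_eq_integral_exp_smul, ← map_smul]
  refine M.integral_comp_comm ?_
  exact hf.bdd_smul 1 (Continuous.aestronglyMeasurable (by fun_prop))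
    (Eventually.of_forall fun p => (Complex.norm_exp_ofReal_mul_I _).le)

/-- The `L²` transform is defined abstractly. Tested against smooth compactly supported functions,
it agrees with the integral transform: as tempered distributions, both move the transform onto the
test function. -/
lemma fourier_toLp_ae_eq {f : ℝ → H} (hf : Integrable f) (hf2 : MemLp f 2) :
    (𝓕 (hf2.toLp f) : Lp H 2 (volume : Measure ℝ)) =ᵐ[volume] 𝓕 f := by
  refine ae_eq_of_integral_contDiff_smul_eq
    ((Lp.memLp _).locallyIntegrable one_le_two) (continuous_fourier hf).locallyIntegrable ?_
  intro g g_smooth g_cpt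
  have hg₁ : HasCompactSupport (Complex.ofRealCLM ∘ g) := g_cpt.comp_left rfl
  have hg₂ : ContDiff ℝ ∞ (Complex.ofRealCLM ∘ g) := by fun_prop
  let φ : SchwartzMap ℝ ℂ := hg₁.toSchwartzMap hg₂
  have hφ : ∀ x, φ x = (g x : ℂ) := fun x => rfl
  have h1 : ∫ x, g x • (𝓕 (hf2.toLp f) : Lp H 2 (volume : Measure ℝ)) x =
      Lp.toTemperedDistribution (𝓕 (hf2.toLp f)) φ := by
    rw [Lp.toTemperedDistribution_apply]
    simp only [hφ, Complex.coe_smul]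
  rw [h1, ← Lp.fourier_toTemperedDistribution_eq, TemperedDistribution.fourier_apply,
    Lp.toTemperedDistribution_apply]
  calc ∫ x, (𝓕 φ) x • (hf2.toLp f) x = ∫ x, (𝓕 (φ : ℝ → ℂ)) x • f x := by
        refine integral_congr_ae ?_
        filter_upwards [hf2.coeFn_toLp] with x hx
        rw [hx, SchwartzMap.fourier_coe]
    _ = ∫ x, φ x • 𝓕 f x := integral_fourier_smul_eq φ.integrable hf
    _ = _ := by simp only [hφ, Complex.coe_smul]

lemma eLpNorm_fourier_eq {f : ℝ → H} (hf : Integrable f) (hf2 : MemLp f 2) :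
    eLpNorm (𝓕 f) 2 volume = eLpNorm f 2 volume := by
  rw [← eLpNorm_congr_ae (fourier_toLp_ae_eq hf hf2), ← Lp.enorm_def, ← ofReal_norm,
    Lp.norm_fourier_eq, Lp.norm_toLp, ENNReal.ofReal_toReal hf2.2.ne]

/-! ### The Duhamel integral -/

attribute [local irreducible] expI

section SelfAdjoint

variable {A : H →ₗ.[ℂ] H} (hA : IsSelfAdjoint A)

/-- The operator `e^{itA}` as a bounded linear map. -/
def expL (t : ℝ) : H →L[ℂ] H :=
  LinearMap.mkContinuous
    { toFun := expI A t, map_add' := expI_add_apply hA t, map_smul' := expI_smul hA t } 1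
    fun x => by simp [norm_expI hA]

lemma expL_apply (t : ℝ) (x : H) : expL hA t x = expI A t x := rfl

include hA

lemma aestronglyMeasurable_expI {μ : Measure ℝ} {f : ℝ → H} (hf : AEStronglyMeasurable f μ)
    {τ : ℝ → ℝ} (hτ : Continuous τ) : AEStronglyMeasurable (fun t => expI A (τ t) (f t)) μ :=
  (continuous_expI hA).comp_aestronglyMeasurable
    (hτ.aestronglyMeasurable.prodMk hf)

lemma integrableOn_Ioi_exp_smul_expI {z : ℂ} (hz : 0 < z.im) (s : ℝ) (x : H) :
    IntegrableOn (fun t : ℝ => Complex.exp (Complex.I * z * t) • expI A (-t) x) (Ioi s) := by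
  refine (integrableOn_exp_mul_Ioi (a := -z.im) (by linarith) s).mul_const ‖x‖ |>.mono' ?_ ?_
  · exact (Continuous.smul (by fun_prop)
      ((continuous_expI_apply hA x).comp continuous_neg)).aestronglyMeasurable
  · refine Eventually.of_forall fun t => ?_
    rw [norm_smul, norm_expI hA, Complex.norm_exp]
    simp

/-- The derivative brings down `-i (A - z)`, which cancels the resolvent. This gives an
antiderivative for the Laplace transform of the group. -/
lemma hasDerivAt_exp_smul_expI {z : ℂ} (hz : z.im ≠ 0) (x : H) (t : ℝ) :
    HasDerivAt (fun t : ℝ => Complex.exp (Complex.I * z * t) • expI A (-t) (resolvent A z x))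
      (-Complex.I • Complex.exp (Complex.I * z * t) • expI A (-t) x) t := by
  have h1 : HasDerivAt (fun t : ℝ => Complex.exp (Complex.I * z * t))
      (Complex.exp (Complex.I * z * t) * (Complex.I * z)) t := by
    have := ((Complex.ofRealCLM.hasDerivAt (x := t)).const_mul (Complex.I * z)).cexp
    simpa using this
  have h2 : HasDerivAt (fun t : ℝ => expI A (-t) (resolvent A z x)) _ t :=
    HasDerivAt.scomp t (hasDerivAt_expI hA ⟨_, resolvent_mem hA hz x⟩ (-t)) (hasDerivAt_neg t)
  refine (h1.smul h2).congr_deriv ?_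
  rw [apply_resolvent hA hz, expI_add_apply hA, expI_smul hA]
  module

/-- The resolvent is the Laplace transform of the unitary group. -/
lemma integral_Ioi_exp_smul_expI {z : ℂ} (hz : 0 < z.im) (s : ℝ) (x : H) :
    ∫ t in Ioi s, Complex.exp (Complex.I * z * t) • expI A (-t) x =
      -Complex.I • Complex.exp (Complex.I * z * s) • expI A (-s) (resolvent A z x) := by
  have h1 := integral_Ioi_of_hasDerivAt_of_tendsto' (m := 0) (a := s)
    (fun t _ => hasDerivAt_exp_smul_expI hA hz.ne' x t)
    ((integrableOn_Ioi_exp_smul_expI hA hz s x).smul (-Complex.I)) (by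
      rw [tendsto_zero_iff_norm_tendsto_zero]
      have h2 : Tendsto (fun t : ℝ => Real.exp (-(z.im * t)) * ‖resolvent A z x‖) atTop (𝓝 0) := by
        have := (Real.tendsto_exp_neg_atTop_nhds_zero.comp
          (tendsto_id.const_mul_atTop hz)).mul_const ‖resolvent A z x‖
        simpa using this
      refine h2.congr fun t => ?_
      rw [norm_smul, norm_expI hA, Complex.norm_exp]
      simp)
  rw [integral_smul, zero_sub] at h1
  have h3 := congrArg (fun v => Complex.I • v) h1
  simp only [smul_smul, mul_neg, Complex.I_mul_I, neg_neg, one_smul] at h3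
  rw [h3, smul_neg, neg_smul]

variable {ε : ℝ} {a b : ℝ} {g : ℝ → H}

/-- The Duhamel integrand. -/
lemma integrable_duhamel_prod (hε : 0 < ε) (hg : Integrable g) (hab : ∀ t ∉ Icc a b, g t = 0) :
    Integrable (fun p : ℝ × ℝ => {q : ℝ × ℝ | q.2 < q.1}.indicator
      (fun q => Real.exp (-ε * q.1) • expI A (-q.1) (g q.2)) p) (volume.prod volume) := by
  have hms : MeasurableSet {q : ℝ × ℝ | q.2 < q.1} := measurableSet_lt measurable_snd measurable_fst
  have hmeas : AEStronglyMeasurable (fun q : ℝ × ℝ => Real.exp (-ε * q.1) • expI A (-q.1) (g q.2))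
      (volume.prod volume) := by
    refine (Continuous.aestronglyMeasurable (f := fun q : ℝ × ℝ => Real.exp (-ε * q.1))
      (by fun_prop)).smul ?_
    exact (continuous_expI hA).comp_aestronglyMeasurable
      ((continuous_fst.neg).aestronglyMeasurable.prodMk hg.1.comp_snd)
  rw [integrable_prod_iff' (hmeas.indicator hms)]
  have hind : ∀ s t : ℝ, {q : ℝ × ℝ | q.2 < q.1}.indicator
      (fun q => Real.exp (-ε * q.1) • expI A (-q.1) (g q.2)) (t, s) =
      (Ioi s).indicator (fun t => Real.exp (-ε * t) • expI A (-t) (g s)) t := by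
    intro s t
    simp only [indicator, mem_ofPred_eq, mem_Ioi]
  have hnorm : ∀ s : ℝ, ∫ t, ‖(Ioi s).indicator
      (fun t => Real.exp (-ε * t) • expI A (-t) (g s)) t‖ = Real.exp (-ε * s) / ε * ‖g s‖ := by
    intro s
    simp only [norm_indicator_eq_indicator_norm, norm_smul, norm_expI hA, Real.norm_eq_abs,
      Real.abs_exp]
    rw [integral_indicator measurableSet_Ioi, integral_mul_const,
      integral_exp_mul_Ioi (by linarith)]
    congr 1
    field_simp
  simp only [hind, hnorm]
  refine ⟨Eventually.of_forall fun s => ?_, ?_⟩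
  · rw [integrable_indicator_iff measurableSet_Ioi]
    have h := integrableOn_Ioi_exp_smul_expI hA (z := ε * Complex.I) (by simpa using hε) s (g s)
    refine h.congr_fun (fun t _ => ?_) measurableSet_Ioi
    simp only
    rw [← Complex.coe_smul, Complex.ofReal_exp]
    congr 2
    push_cast
    linear_combination (ε * t : ℂ) * Complex.I_mul_I
  · refine (hg.norm.const_mul (Real.exp (-ε * a) / ε)).mono' ?_ (Eventually.of_forall fun s => ?_)
    · exact AEStronglyMeasurable.mul (Continuous.aestronglyMeasurable (by fun_prop)) hg.norm.1
    · rw [Real.norm_of_nonneg (by positivity)]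
      by_cases hs : s ∈ Icc a b
      · gcongr ?_ / ε * ‖g s‖
        exact Real.exp_le_exp.2 (by nlinarith [hs.1])
      · rw [hab s hs]; simp

lemma duhamel_eq (hg : Integrable g) (t : ℝ) :
    Real.exp (-ε * t) • expI A (-t) (∫ s in Iio t, g s) =
      ∫ s, {q : ℝ × ℝ | q.2 < q.1}.indicator
        (fun q => Real.exp (-ε * q.1) • expI A (-q.1) (g q.2)) (t, s) := by
  have hind : ∀ s : ℝ, {q : ℝ × ℝ | q.2 < q.1}.indicator
      (fun q => Real.exp (-ε * q.1) • expI A (-q.1) (g q.2)) (t, s) =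
      (Iio t).indicator (fun s => Real.exp (-ε * t) • expI A (-t) (g s)) s := by
    intro s
    simp only [indicator, mem_ofPred_eq, mem_Iio]
  simp only [hind]
  rw [integral_indicator measurableSet_Iio, integral_smul]
  congr 1
  simp only [← expL_apply hA]
  exact ((expL hA (-t)).integral_comp_comm hg.integrableOn).symm

lemma integrable_duhamel (hε : 0 < ε) (hg : Integrable g) (hab : ∀ t ∉ Icc a b, g t = 0) :
    Integrable fun t => Real.exp (-ε * t) • expI A (-t) (∫ s in Iio t, g s) := by
  simp only [duhamel_eq hA hg]
  exact (integrable_duhamel_prod hA hε hg hab).integral_prod_left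

/-- The function is integrable and bounded: it vanishes for `t < a`, and for `t ≥ a` its norm is at
most `e^{-εa} ‖g‖₁`. -/
lemma memLp_duhamel (hε : 0 < ε) (hg : Integrable g) (hab : ∀ t ∉ Icc a b, g t = 0) :
    MemLp (fun t => Real.exp (-ε * t) • expI A (-t) (∫ s in Iio t, g s)) 2 := by
  have h := integrable_duhamel hA hε hg hab
  rw [memLp_two_iff_integrable_sq_norm h.1]
  refine (h.norm.mul_const (Real.exp (-ε * a) * ∫ s, ‖g s‖)).mono' (h.1.norm.pow 2)
    (Eventually.of_forall fun t => ?_)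
  rw [Real.norm_of_nonneg (by positivity), sq]
  gcongr
  rw [norm_smul, norm_expI hA, Real.norm_eq_abs, Real.abs_exp]
  rcases le_or_gt a t with hat | hat
  · exact mul_le_mul (Real.exp_le_exp.2 (by nlinarith)) ((norm_integral_le_integral_norm _).trans
      (setIntegral_le_integral hg.norm (Eventually.of_forall fun _ => norm_nonneg _)))
      (norm_nonneg _) (Real.exp_nonneg _)
  · rw [setIntegral_eq_zero_of_forall_eq_zero (fun s hs => hab s fun h => ?_)]
    · simp; positivity
    · exact absurd h.1 (not_le.2 (lt_trans hs hat))

omit hA [InnerProductSpace ℂ H] [CompleteSpace H] in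
lemma integrable_of_memLp_two (hg : MemLp g 2) (hab : ∀ t ∉ Icc a b, g t = 0) :
    Integrable g := by
  have h : Integrable g (volume.restrict (Icc a b)) :=
    (hg.restrict (Icc a b)).integrable one_le_two
  exact (integrableOn_iff_integrable_of_support_subset fun t ht => by_contra fun h =>
    ht (hab t h)).1 h

omit hA [CompleteSpace H] in
lemma norm_exp_smul_le (ε : ℝ) (hab : ∀ t ∉ Icc a b, g t = 0) (t : ℝ) :
    ‖Real.exp (-ε * t) • g t‖ ≤ ‖Real.exp (|ε| * (|a| + |b|)) • g t‖ := by
  by_cases ht : t ∈ Icc a b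
  · rw [norm_smul, norm_smul, Real.norm_eq_abs, Real.abs_exp, Real.norm_eq_abs, Real.abs_exp]
    refine mul_le_mul_of_nonneg_right (Real.exp_le_exp.2 ?_) (norm_nonneg _)
    have h1 : |t| ≤ |a| + |b| := by
      rw [abs_le]
      constructor <;> linarith [ht.1, ht.2, neg_abs_le a, le_abs_self b, abs_nonneg a, abs_nonneg b]
    calc -ε * t ≤ |-ε * t| := le_abs_self _
      _ = |ε| * |t| := by rw [abs_mul, abs_neg]
      _ ≤ _ := by gcongr
  · rw [hab t ht]; simp

lemma memLp_exp_smul_expI {p : ℝ≥0∞} (hg : MemLp g p) (hab : ∀ t ∉ Icc a b, g t = 0) :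
    MemLp (fun t => Real.exp (-ε * t) • expI A (-t) (g t)) p := by
  refine (hg.const_smul (Real.exp (|ε| * (|a| + |b|)))).mono ?_ (Eventually.of_forall fun t => ?_)
  · exact (Continuous.aestronglyMeasurable (f := fun t : ℝ => Real.exp (-ε * t))
      (by fun_prop)).smul (aestronglyMeasurable_expI hA hg.1 continuous_neg)
  · rw [norm_smul, norm_expI hA, ← norm_smul]
    exact norm_exp_smul_le ε hab t

lemma integrable_exp_smul_expI (hg : Integrable g) (hab : ∀ t ∉ Icc a b, g t = 0) :
    Integrable (fun t => Real.exp (-ε * t) • expI A (-t) (g t)) :=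
  memLp_one_iff_integrable.1 (memLp_exp_smul_expI hA (memLp_one_iff_integrable.2 hg) hab)

/-- Exchange the two integrations over `s < t`. For fixed `s` the integral over `t > s` is the
Laplace transform of the group, hence a resolvent at `z`, which is independent of `s` and comes out
of the outer integral. -/
lemma fourier_duhamel (hε : 0 < ε) (hg : Integrable g) (hab : ∀ t ∉ Icc a b, g t = 0) (ξ : ℝ) :
    𝓕 (fun t => Real.exp (-ε * t) • expI A (-t) (∫ s in Iio t, g s)) ξ =
      -Complex.I • resolvent A (((-2 * Real.pi * ξ : ℝ) : ℂ) + ε * Complex.I)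
        (𝓕 (fun t => Real.exp (-ε * t) • expI A (-t) (g t)) ξ) := by
  -- Chosen so that the Fourier phase times the weight, `e^{-2πiξt} e^{-εt}`, equals `e^{izt}`.
  set z : ℂ := ((-2 * Real.pi * ξ : ℝ) : ℂ) + ε * Complex.I with hzdef
  have hz : 0 < z.im := by
    rw [hzdef, Complex.add_im, Complex.ofReal_im, zero_add, Complex.mul_I_im, Complex.ofReal_re]
    exact hε
  have hexp : ∀ (t : ℝ) (x : H), Complex.exp (((-2 * Real.pi * t * ξ : ℝ) : ℂ) * Complex.I) •
      Real.exp (-ε * t) • x = Complex.exp (Complex.I * z * t) • x := by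
    intro t x
    rw [← Complex.coe_smul, smul_smul, Complex.ofReal_exp, ← Complex.exp_add, hzdef]
    congr 2
    push_cast
    linear_combination (-ε * t : ℂ) * Complex.I_mul_I
  simp only [Real.fourier_real_eq_integral_exp_smul, hexp]
  have hexp' : ∀ t : ℝ, ‖Complex.exp (((-2 * Real.pi * t * ξ : ℝ) : ℂ) * Complex.I)‖ = 1 :=
    fun t => Complex.norm_exp_ofReal_mul_I _
  have hprod := integrable_duhamel_prod hA hε hg hab
  have hprod2 : Integrable (fun p : ℝ × ℝ =>
      Complex.exp (((-2 * Real.pi * p.1 * ξ : ℝ) : ℂ) * Complex.I) •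
      {q : ℝ × ℝ | q.2 < q.1}.indicator
        (fun q => Real.exp (-ε * q.1) • expI A (-q.1) (g q.2)) p) (volume.prod volume) :=
    hprod.bdd_smul 1 (Continuous.aestronglyMeasurable (by fun_prop))
      (Eventually.of_forall fun p => (hexp' p.1).le)
  calc ∫ t : ℝ, Complex.exp (Complex.I * z * t) • expI A (-t) (∫ s in Iio t, g s)
      = ∫ t : ℝ, ∫ s : ℝ, Complex.exp (((-2 * Real.pi * t * ξ : ℝ) : ℂ) * Complex.I) •
          {q : ℝ × ℝ | q.2 < q.1}.indicator
            (fun q => Real.exp (-ε * q.1) • expI A (-q.1) (g q.2)) (t, s) := by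
        refine integral_congr_ae (Eventually.of_forall fun t => ?_)
        simp only
        rw [integral_smul, ← duhamel_eq hA hg, hexp]
    _ = ∫ s : ℝ, ∫ t : ℝ, Complex.exp (((-2 * Real.pi * t * ξ : ℝ) : ℂ) * Complex.I) •
          {q : ℝ × ℝ | q.2 < q.1}.indicator
            (fun q => Real.exp (-ε * q.1) • expI A (-q.1) (g q.2)) (t, s) :=
        integral_integral_swap hprod2
    _ = ∫ s : ℝ, -Complex.I • resolvent A z
          (Complex.exp (Complex.I * z * s) • expI A (-s) (g s)) := by
        refine integral_congr_ae (Eventually.of_forall fun s => ?_)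
        simp only
        rw [map_smul, resolvent_expI hA hz.ne', ← integral_Ioi_exp_smul_expI hA hz,
          ← integral_indicator measurableSet_Ioi]
        refine integral_congr_ae (Eventually.of_forall fun t => ?_)
        by_cases hst : s < t
        · simp only [indicator, mem_ofPred_eq, mem_Ioi, hst, if_true, hexp]
        · simp only [indicator, mem_ofPred_eq, mem_Ioi, hst, if_false, smul_zero]
    _ = _ := by
        rw [integral_smul, (resolvent A z).integral_comp_comm]
        have h : Integrable fun t : ℝ =>
            Complex.exp (((-2 * Real.pi * t * ξ : ℝ) : ℂ) * Complex.I) •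
              Real.exp (-ε * t) • expI A (-t) (g t) :=
          (integrable_exp_smul_expI hA (ε := ε) hg hab).bdd_smul 1
          (Continuous.aestronglyMeasurable (by fun_prop))
          (Eventually.of_forall fun p => (hexp' p).le)
        simpa only [hexp] using h

/-- The `L²` bound for `M e^{-itA} w(t)` in terms of `N w'`, when `M (A - l - iε)⁻¹` is dominated
by `N` uniformly in `l`. -/
lemma eLpNorm_duhamel_le {M N : H →L[ℂ] H} (hε : 0 < ε)
    (hM : ∀ (l : ℝ) (x : H), ‖M (resolvent A (l + ε * Complex.I) x)‖ ≤ ‖N x‖)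
    (hN : ∀ (t : ℝ) (x : H), N (expI A t x) = expI A t (N x))
    (hg : MemLp g 2) (hab : ∀ t ∉ Icc a b, g t = 0) :
    eLpNorm (fun t => Real.exp (-ε * t) • M (expI A (-t) (∫ s in Iio t, g s))) 2 volume ≤
      eLpNorm (fun t => Real.exp (-ε * t) • N (g t)) 2 volume := by
  have hg1 : Integrable g := integrable_of_memLp_two hg hab
  have hu := integrable_duhamel hA hε hg1 hab
  have hu2 := memLp_duhamel hA hε hg1 hab
  have hh := integrable_exp_smul_expI hA (ε := ε) hg1 hab
  have hh2 : MemLp (fun t => Real.exp (-ε * t) • expI A (-t) (g t)) 2 :=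
    memLp_exp_smul_expI hA hg hab
  have h1 : (fun t => Real.exp (-ε * t) • M (expI A (-t) (∫ s in Iio t, g s))) =
      fun t => M (Real.exp (-ε * t) • expI A (-t) (∫ s in Iio t, g s)) := by
    funext t
    rw [← Complex.coe_smul, ← Complex.coe_smul, map_smul]
  rw [h1, ← eLpNorm_fourier_eq (M.integrable_comp hu) (M.comp_memLp' hu2)]
  -- On the Fourier side the Duhamel integral is a resolvent with imaginary shift `ε`, so the
  -- hypothesis on `M` applies at each frequency.
  have h2 : ∀ ξ, ‖𝓕 (fun t => M (Real.exp (-ε * t) • expI A (-t) (∫ s in Iio t, g s))) ξ‖ ≤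
      ‖𝓕 (fun t => N (Real.exp (-ε * t) • expI A (-t) (g t))) ξ‖ := by
    intro ξ
    rw [fourier_comp hu, fourier_comp hh, fourier_duhamel hA hε hg1 hab, map_smul, norm_smul, norm_neg, Complex.norm_I, one_mul]
    exact hM _ _
  refine (eLpNorm_mono h2).trans ?_
  rw [eLpNorm_fourier_eq (N.integrable_comp hh) (N.comp_memLp' hh2)]
  refine eLpNorm_mono fun t => ?_
  rw [← Complex.coe_smul, ← Complex.coe_smul, map_smul, norm_smul, norm_smul, hN, norm_expI hA]

end SelfAdjoint

/-! ### Representation of `H¹` functions as primitives -/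

/-- The primitive `w₀ + ∫₀ᵗ g`. -/
def prim (w₀ : H) (g : ℝ → H) (t : ℝ) : H := w₀ + ∫ s in (0 : ℝ)..t, g s

omit [CompleteSpace H] in
@[simp] lemma prim_zero (w₀ : H) (g : ℝ → H) : prim w₀ g 0 = w₀ := by simp [prim]

variable {T : ℝ}

omit [InnerProductSpace ℂ H] [CompleteSpace H] in
lemma integrableOn_of_memLp {g : ℝ → H} (hg : MemLp g 2 (volI T)) :
    IntegrableOn g (Ioo 0 T) := hg.integrable one_le_two

omit [InnerProductSpace ℂ H] [CompleteSpace H] in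
lemma intervalIntegrable_of_memLp {g : ℝ → H} (hT : 0 < T) (hg : MemLp g 2 (volI T)) :
    IntervalIntegrable g volume 0 T := by
  rw [intervalIntegrable_iff_integrableOn_Ioo_of_le hT.le]
  exact integrableOn_of_memLp hg

omit [InnerProductSpace ℂ H] [CompleteSpace H] in
lemma intervalIntegrable_of_memLp' {g : ℝ → H} (hT : 0 < T) (hg : MemLp g 2 (volI T)) {t : ℝ}
    (ht : t ∈ Icc 0 T) : IntervalIntegrable g volume 0 t :=
  (intervalIntegrable_of_memLp hT hg).mono_set (by
    rw [uIcc_of_le ht.1, uIcc_of_le hT.le]; exact Icc_subset_Icc_right ht.2)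

omit [CompleteSpace H] in
lemma continuousOn_prim (hT : 0 < T) (w₀ : H) {g : ℝ → H} (hg : MemLp g 2 (volI T)) :
    ContinuousOn (prim w₀ g) (Icc 0 T) := by
  have h := intervalIntegral.continuousOn_primitive_interval (f := g) (a := 0) (b := T)
    (μ := volume) (by
      rw [uIcc_of_le hT.le, integrableOn_Icc_iff_integrableOn_Ioo]
      exact integrableOn_of_memLp hg)
  rw [uIcc_of_le hT.le] at h
  exact continuousOn_const.add h

omit [InnerProductSpace ℂ H] [CompleteSpace H] in
lemma memLp_of_continuousOn {w : ℝ → H} (hw : ContinuousOn w (Icc 0 T)) (p : ℝ≥0∞) :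
    MemLp w p (volI T) := by
  obtain ⟨C, hC⟩ := isCompact_Icc.exists_bound_of_continuousOn hw
  refine MemLp.of_bound ((hw.mono Ioo_subset_Icc_self).aestronglyMeasurable measurableSet_Ioo) C ?_
  filter_upwards [ae_restrict_mem measurableSet_Ioo] with t ht
  exact hC t (Ioo_subset_Icc_self ht)

/-! ### Test functions and weak derivatives of primitives. -/

lemma eq_zero_of_tsupport {φ : ℝ → ℝ} (h : tsupport φ ⊆ Ioo 0 T) {t : ℝ} (ht : t ∉ Ioo 0 T) :
    φ t = 0 := image_eq_zero_of_notMem_tsupport fun h' => ht (h h')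

lemma setIntegral_deriv_eq {φ : ℝ → ℝ} (hφ : ContDiff ℝ ∞ φ) (hs : tsupport φ ⊆ Ioo 0 T)
    {s : ℝ} (hs' : s ≤ T) : ∫ t in Ioo s T, deriv φ t = -φ s := by
  rw [← integral_Ioc_eq_integral_Ioo, ← intervalIntegral.integral_of_le hs',
    intervalIntegral.integral_deriv_eq_sub (fun t _ => (hφ.differentiable (by simp)) t)
      ((hφ.continuous_deriv (by simp)).intervalIntegrable _ _),
    eq_zero_of_tsupport hs (by simp), zero_sub]

/-- Fubini on the triangle `s < t`: integrating `φ'` over `(s, T)` leaves `-φ(s)`. The initial value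
drops out because `φ'` has integral zero. -/
lemma isWeakDeriv_prim (hT : 0 < T) (w₀ : H) {g : ℝ → H} (hg : MemLp g 2 (volI T)) :
    IsWeakDeriv T (prim w₀ g) g := by
  intro φ hφ hc hs
  have hg1 : Integrable g (volI T) := hg.integrable one_le_two
  have hφ' : Continuous (deriv φ) := hφ.continuous_deriv (by simp)
  have hd : Integrable (deriv φ) (volI T) :=
    (hφ'.integrableOn_Icc (a := 0) (b := T)).mono_set Ioo_subset_Icc_self
  have hms : MeasurableSet {q : ℝ × ℝ | q.2 < q.1} := measurableSet_lt measurable_snd measurable_fst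
  have hprod : Integrable (fun p : ℝ × ℝ => {q : ℝ × ℝ | q.2 < q.1}.indicator
      (fun q => deriv φ q.1 • g q.2) p) ((volI T).prod (volI T)) :=
    (hd.smul_prod hg1).indicator hms
  have hcont : Integrable (fun t => ∫ s in (0 : ℝ)..t, g s) (volI T) := by
    have h := memLp_of_continuousOn (continuousOn_prim hT 0 hg) 1
    rw [memLp_one_iff_integrable] at h
    exact h.congr (Eventually.of_forall fun t => zero_add _)
  obtain ⟨C, hC⟩ := (hc.deriv).exists_bound_of_continuous hφ'
  have h1 : Integrable (fun t => deriv φ t • ∫ s in (0 : ℝ)..t, g s) (volI T) :=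
    hcont.bdd_smul (𝕜 := ℝ) C hφ'.aestronglyMeasurable (Eventually.of_forall hC)
  simp only [prim, smul_add]
  rw [integral_add (hd.smul_const w₀) h1, integral_smul_const,
    setIntegral_deriv_eq hφ hs hT.le, eq_zero_of_tsupport hs (by simp), neg_zero, zero_smul,
    zero_add]
  calc ∫ t, deriv φ t • (∫ s in (0 : ℝ)..t, g s) ∂(volI T)
      = ∫ t, ∫ s, {q : ℝ × ℝ | q.2 < q.1}.indicator
          (fun q => deriv φ q.1 • g q.2) (t, s) ∂(volI T) ∂(volI T) := by
        refine setIntegral_congr_fun measurableSet_Ioo fun t ht => ?_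
        rw [intervalIntegral.integral_of_le ht.1.le, ← integral_smul]
        have : ∀ s, {q : ℝ × ℝ | q.2 < q.1}.indicator (fun q => deriv φ q.1 • g q.2) (t, s) =
            (Iio t).indicator (fun s => deriv φ t • g s) s := by
          intro s; simp only [indicator, mem_ofPred_eq, mem_Iio]
        simp only [this]
        rw [integral_indicator measurableSet_Iio, Measure.restrict_restrict measurableSet_Iio,
          integral_Ioc_eq_integral_Ioo]
        congr 2
        ext s
        simp only [mem_Ioo, mem_inter_iff, mem_Iio]
        exact ⟨fun h => ⟨h.2, h.1, h.2.trans ht.2⟩, fun h => ⟨h.2.1, h.1⟩⟩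
    _ = ∫ s, ∫ t, {q : ℝ × ℝ | q.2 < q.1}.indicator
          (fun q => deriv φ q.1 • g q.2) (t, s) ∂(volI T) ∂(volI T) := integral_integral_swap hprod
    _ = ∫ s, -(φ s • g s) ∂(volI T) := by
        refine setIntegral_congr_fun measurableSet_Ioo fun s hs' => ?_
        have : ∀ t, {q : ℝ × ℝ | q.2 < q.1}.indicator (fun q => deriv φ q.1 • g q.2) (t, s) =
            (Ioi s).indicator (fun t => deriv φ t • g s) t := by
          intro t; simp only [indicator, mem_ofPred_eq, mem_Ioi]
        simp only [this]
        rw [integral_indicator measurableSet_Ioi, Measure.restrict_restrict measurableSet_Ioi,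
          integral_smul_const, ← neg_smul, ← setIntegral_deriv_eq hφ hs hs'.2.le]
        congr 3
        ext t
        simp only [mem_Ioo, mem_inter_iff, mem_Ioi]
        exact ⟨fun h => ⟨h.1, h.2.2⟩, fun h => ⟨h.1, hs'.1.trans h.1, h.2⟩⟩
    _ = _ := integral_neg _

omit [CompleteSpace H] in
lemma integrable_smul_of_test {φ : ℝ → ℝ} (hφ : Continuous φ) (hc : HasCompactSupport φ)
    {v : ℝ → H} (hv : Integrable v (volI T)) : Integrable (fun t => φ t • v t) (volI T) := by
  obtain ⟨C, hC⟩ := hc.exists_bound_of_continuous hφ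
  exact hv.bdd_smul (𝕜 := ℝ) C hφ.aestronglyMeasurable (Eventually.of_forall hC)

lemma setIntegral_eq_of_tsupport {φ : ℝ → ℝ} (hs : tsupport φ ⊆ Ioo 0 T) :
    ∫ t, φ t ∂(volI T) = ∫ t, φ t :=
  setIntegral_eq_integral_of_forall_compl_eq_zero fun _ ht => eq_zero_of_tsupport hs ht

/-- A smooth function with compact support in `(0, T)` and vanishing integral is the derivative of
such a function. -/
lemma exists_test_deriv_eq (hT : 0 < T) {η : ℝ → ℝ} (hη : ContDiff ℝ ∞ η)
    (hc : HasCompactSupport η) (hs : tsupport η ⊆ Ioo 0 T) (h0 : ∫ t, η t = 0) :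
    ∃ φ : ℝ → ℝ, ContDiff ℝ ∞ φ ∧ HasCompactSupport φ ∧ tsupport φ ⊆ Ioo 0 T ∧ deriv φ = η := by
  -- Inserting `T / 2` keeps the set nonempty when `η = 0`, so that its infimum and supremum lie in
  -- `(0, T)`.
  have hK : IsCompact (insert (T / 2) (tsupport η)) := hc.isCompact.insert _
  have hKs : insert (T / 2) (tsupport η) ⊆ Ioo 0 T :=
    insert_subset ⟨by linarith, by linarith⟩ hs
  have hne : (insert (T / 2) (tsupport η)).Nonempty := insert_nonempty _ _
  set a := sInf (insert (T / 2) (tsupport η)) with ha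
  set b := sSup (insert (T / 2) (tsupport η)) with hb
  have ha' := hKs (hK.sInf_mem hne)
  have hb' := hKs (hK.sSup_mem hne)
  have hzero : ∀ t ∉ Icc a b, η t = 0 := fun t ht => image_eq_zero_of_notMem_tsupport fun h' =>
    ht ⟨csInf_le hK.bddBelow (mem_insert_of_mem _ h'), le_csSup hK.bddAbove (mem_insert_of_mem _ h')⟩
  let φ : ℝ → ℝ := fun t => ∫ s in a..t, η s
  have hder : ∀ t, HasDerivAt φ (η t) t := fun t =>
    intervalIntegral.integral_hasDerivAt_right (hη.continuous.intervalIntegrable _ _)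
      (hη.continuous.stronglyMeasurableAtFilter _ _) hη.continuous.continuousAt
  have hd : deriv φ = η := funext fun t => (hder t).deriv
  have hsupp : ∀ t ∉ Icc a b, φ t = 0 := by
    intro t ht
    rcases lt_or_ge t a with hta | hta
    · refine intervalIntegral.integral_zero_ae (Eventually.of_forall fun s hs => ?_)
      have hs' : s < a ∨ s = a := by
        rw [uIoc_of_ge hta.le] at hs
        exact lt_or_eq_of_le hs.2
      rcases hs' with h | h
      · exact hzero s fun h' => absurd h'.1 (not_le.2 h)
      · rw [h]
        have hcl : closure (Iio a) ⊆ η ⁻¹' {0} :=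
          closure_minimal (fun u hu => hzero u fun h' => absurd h'.1 (not_le.2 hu))
            (isClosed_singleton.preimage hη.continuous)
        rw [closure_Iio] at hcl
        exact hcl (mem_Iic.2 le_rfl)
    · have htb : b < t := lt_of_not_ge fun h => ht ⟨hta, h⟩
      have h1 : φ t = ∫ s, η s := by
        change ∫ s in a..t, η s = _
        rw [intervalIntegral.integral_of_le hta, ← integral_Icc_eq_integral_Ioc]
        exact setIntegral_eq_integral_of_forall_compl_eq_zero fun s hs =>
          hzero s fun h => hs ⟨h.1, h.2.trans htb.le⟩
      rw [h1, h0]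
  have hts : tsupport φ ⊆ Icc a b := closure_minimal
    (fun t ht => by_contra fun h => ht (hsupp t h)) isClosed_Icc
  refine ⟨φ, ?_, HasCompactSupport.of_support_subset_isCompact isCompact_Icc
    (subset_closure.trans hts), hts.trans fun t ht => ⟨ha'.1.trans_le ht.1, ht.2.trans_lt hb'.2⟩, hd⟩
  rw [contDiff_infty_iff_deriv, hd]
  exact ⟨fun t => (hder t).differentiableAt, hη⟩

/-- The lemma of du Bois-Reymond. -/
lemma ae_eq_const_of_isWeakDeriv_zero (hT : 0 < T) {v : ℝ → H} (hv : Integrable v (volI T))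
    (h : ∀ φ : ℝ → ℝ, ContDiff ℝ ∞ φ → HasCompactSupport φ → tsupport φ ⊆ Ioo 0 T →
      ∫ t, deriv φ t • v t ∂(volI T) = 0) : ∃ m : H, ∀ᵐ t, t ∈ Ioo 0 T → v t = m := by
  let B : ContDiffBump (T / 2) := ⟨T / 8, T / 4, by linarith, by linarith⟩
  let ψ : ℝ → ℝ := B.normed volume
  have hψ : ContDiff ℝ ∞ ψ := B.contDiff_normed
  have hψc : HasCompactSupport ψ := B.hasCompactSupport_normed
  have hψs : tsupport ψ ⊆ Ioo 0 T := by
    rw [B.tsupport_normed_eq, Real.closedBall_eq_Icc]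
    intro t ht
    have h1 : T / 2 - T / 4 ≤ t := ht.1
    have h2 : t ≤ T / 2 + T / 4 := ht.2
    exact ⟨by linarith, by linarith⟩
  have hψi : ∫ t, ψ t = 1 := B.integral_normed
  refine ⟨∫ t, ψ t • v t ∂(volI T), ?_⟩
  set m := ∫ t, ψ t • v t ∂(volI T) with hm
  have hvm : Integrable (fun t => v t - m) (volI T) := hv.sub (integrable_const m)
  suffices ∀ᵐ t, t ∈ Ioo 0 T → v t - m = 0 by
    filter_upwards [this] with t ht h
    exact sub_eq_zero.1 (ht h)
  refine isOpen_Ioo.ae_eq_zero_of_integral_contDiff_smul_eq_zero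
    (IntegrableOn.locallyIntegrableOn hvm) fun χ hχ hχc hχs => ?_
  set c := ∫ t, χ t with hc
  have hηc : HasCompactSupport (fun t => χ t - c * ψ t) := hχc.sub (hψc.mul_left)
  -- Since `ψ` has integral one, `χ - c ψ` has integral zero and is the derivative of a test
  -- function. Testing `v` with it gives `∫ χ v = c m`, where `m` is the `ψ`-average of `v`.
  obtain ⟨φ, hφ, hφc, hφs, hφd⟩ := exists_test_deriv_eq hT (η := fun t => χ t - c * ψ t)
    (hχ.sub (contDiff_const.mul hψ)) hηc
    ((tsupport_sub _ _).trans (union_subset hχs ((tsupport_mul_subset_right).trans hψs))) (by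
      rw [integral_sub (hχ.continuous.integrable_of_hasCompactSupport hχc)
        ((hψ.continuous.integrable_of_hasCompactSupport hψc).const_mul c), integral_const_mul,
        hψi, mul_one, sub_self])
  have h1 := h φ hφ hφc hφs
  rw [hφd] at h1
  have h2 : ∀ t, (χ t - c * ψ t) • v t = χ t • v t - c • ψ t • v t := by
    intro t; rw [sub_smul, mul_smul]
  simp only [h2] at h1
  have hχv := integrable_smul_of_test hχ.continuous hχc hv
  have hψv : Integrable (fun t => c • ψ t • v t) (volI T) :=
    (integrable_smul_of_test hψ.continuous hψc hv).smul c
  rw [integral_sub hχv hψv, integral_smul, ← hm] at h1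
  rw [← setIntegral_eq_integral_of_forall_compl_eq_zero (s := Ioo 0 T) fun t ht => by
    rw [eq_zero_of_tsupport hχs ht, zero_smul]]
  simp only [smul_sub]
  rw [integral_sub hχv ((integrable_smul_of_test hχ.continuous hχc (integrable_const m))),
    integral_smul_const, setIntegral_eq_of_tsupport hχs]
  exact h1

omit [CompleteSpace H] in
lemma weakDeriv_spec {w : ℝ → H} (hw : MemH1 T w) :
    MemLp (weakDeriv T w) 2 (volI T) ∧ IsWeakDeriv T w (weakDeriv T w) := by
  have h := hw.2.1
  rw [weakDeriv, dif_pos h]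
  exact h.choose_spec

/-- An element of `H¹(I, H)` is the primitive of its weak derivative. -/
lemma MemH1.eq_prim (hT : 0 < T) {w : ℝ → H} (hw : MemH1 T w) :
    EqOn w (prim (w 0) (weakDeriv T w)) (Icc 0 T) := by
  obtain ⟨hg, hwd⟩ := weakDeriv_spec hw
  set g := weakDeriv T w
  have hp := continuousOn_prim hT (w 0) hg
  have hwi : Integrable w (volI T) := hw.1.integrable one_le_two
  have hpi : Integrable (prim (w 0) g) (volI T) :=
    memLp_one_iff_integrable.1 (memLp_of_continuousOn hp 1)
  obtain ⟨m, hm⟩ := ae_eq_const_of_isWeakDeriv_zero hT (hwi.sub hpi) fun φ hφ hc hs => by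
    have hd : Continuous (deriv φ) := hφ.continuous_deriv (by simp)
    simp only [Pi.sub_apply, smul_sub]
    rw [integral_sub (integrable_smul_of_test hd hc.deriv hwi)
      (integrable_smul_of_test hd hc.deriv hpi), hwd φ hφ hc hs,
      isWeakDeriv_prim hT (w 0) hg φ hφ hc hs, sub_self]
  have h1 : (w - prim (w 0) g) =ᵐ[volume.restrict (Icc 0 T)] fun _ => m := by
    rw [← restrict_Ioo_eq_restrict_Icc]
    exact (ae_restrict_iff' measurableSet_Ioo).2 hm
  have h2 := Measure.eqOn_Icc_of_ae_eq volume hT.ne h1 (hw.2.2.sub hp) continuousOn_const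
  -- The path and the primitive agree at time `0`, so the constant by which they differ is zero.
  have h3 : (0 : H) = m := by
    have := h2 (left_mem_Icc.2 hT.le)
    simpa using this
  intro t ht
  have h4 := h2 ht
  simp only [Pi.sub_apply] at h4
  rw [← h3, sub_eq_zero] at h4
  exact h4

/-- Primitives of `L²` functions belong to `H¹(I, H)`. -/
lemma memH1_of_eqOn_prim (hT : 0 < T) {w₀ : H} {w g : ℝ → H} (hg : MemLp g 2 (volI T))
    (hw : EqOn w (prim w₀ g) (Icc 0 T)) : MemH1 T w := by
  have hc : ContinuousOn w (Icc 0 T) := (continuousOn_prim hT w₀ hg).congr hw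
  refine ⟨memLp_of_continuousOn hc 2, ⟨g, hg, fun φ hφ hφc hs => ?_⟩, hc⟩
  rw [← isWeakDeriv_prim hT w₀ hg φ hφ hφc hs]
  refine setIntegral_congr_fun measurableSet_Ioo fun t ht => ?_
  rw [hw (Ioo_subset_Icc_self ht)]

/-- `weakDeriv` is an arbitrary choice; uniqueness of weak derivatives identifies it almost
everywhere. -/
lemma weakDeriv_ae_eq (hT : 0 < T) {w₀ : H} {w g : ℝ → H} (hg : MemLp g 2 (volI T))
    (hw : EqOn w (prim w₀ g) (Icc 0 T)) : weakDeriv T w =ᵐ[volI T] g := by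
  have hw' := memH1_of_eqOn_prim hT hg hw
  obtain ⟨hg', hwd⟩ := weakDeriv_spec hw'
  have hi := hg.integrable one_le_two
  have hi' := hg'.integrable one_le_two
  have h : ∀ᵐ t, t ∈ Ioo 0 T → weakDeriv T w t - g t = 0 := by
    refine isOpen_Ioo.ae_eq_zero_of_integral_contDiff_smul_eq_zero
      (IntegrableOn.locallyIntegrableOn (hi'.sub hi)) fun φ hφ hφc hs => ?_
    rw [← setIntegral_eq_integral_of_forall_compl_eq_zero (s := Ioo 0 T) fun t ht => by
      rw [eq_zero_of_tsupport hs ht, zero_smul]]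
    simp only [smul_sub]
    rw [integral_sub (integrable_smul_of_test hφ.continuous hφc hi')
      (integrable_smul_of_test hφ.continuous hφc hi), sub_eq_zero, ← neg_inj,
      ← hwd φ hφ hφc hs, ← isWeakDeriv_prim hT w₀ hg φ hφ hφc hs]
    refine setIntegral_congr_fun measurableSet_Ioo fun t ht => ?_
    rw [hw (Ioo_subset_Icc_self ht)]
  refine (ae_restrict_iff' measurableSet_Ioo).2 ?_
  filter_upwards [h] with t ht h
  exact sub_eq_zero.1 (ht h)

/-! ### The perturbation along the free evolution -/

section EvalOp

variable {W : H →ₗ.[ℂ] H}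

omit [CompleteSpace H] in
lemma evalOp_of_mem {x : H} (hx : x ∈ W.domain) : evalOp W x = W ⟨x, hx⟩ := dif_pos hx

omit [CompleteSpace H] in
lemma evalOp_add {x y : H} (hx : x ∈ W.domain) (hy : y ∈ W.domain) :
    evalOp W (x + y) = evalOp W x + evalOp W y := by
  rw [evalOp_of_mem hx, evalOp_of_mem hy, evalOp_of_mem (W.domain.add_mem hx hy)]
  exact W.map_add ⟨x, hx⟩ ⟨y, hy⟩

omit [CompleteSpace H] in
lemma evalOp_smul {x : H} (hx : x ∈ W.domain) (k : ℂ) : evalOp W (k • x) = k • evalOp W x := by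
  rw [evalOp_of_mem hx, evalOp_of_mem (W.domain.smul_mem k hx)]
  exact W.map_smul k ⟨x, hx⟩

omit [CompleteSpace H] in
lemma evalOp_of_tendsto (hW : W.IsClosed) {x : ℕ → H} {y v : H} (hx : ∀ n, x n ∈ W.domain)
    (hxy : Tendsto x atTop (𝓝 y)) (hv : Tendsto (fun n => evalOp W (x n)) atTop (𝓝 v)) :
    y ∈ W.domain ∧ evalOp W y = v := by
  have hg : _root_.IsClosed (W.graph : Set (H × H)) := hW
  have h : (y, v) ∈ W.graph := hg.mem_of_tendsto (hxy.prodMk_nhds hv) (Eventually.of_forall fun n => by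
    rw [evalOp_of_mem (hx n)]
    exact W.mem_graph ⟨x n, hx n⟩)
  obtain ⟨u, hu1, hu2⟩ := (LinearPMap.mem_graph_iff W).1 h
  simp only at hu1 hu2
  subst hu1
  exact ⟨u.2, by rw [evalOp_of_mem u.2, ← hu2]⟩

end EvalOp

/-- A dominated sequence converging to zero pointwise converges to zero in `L²`. -/
lemma tendsto_eLpNorm_two_of_dominated {α E F : Type*} [MeasurableSpace α] {μ : Measure α}
    [NormedAddCommGroup E] [NormedAddCommGroup F] {f : ℕ → α → E} {G : α → F}
    (hf : ∀ n, AEStronglyMeasurable (f n) μ) (hG : MemLp G 2 μ)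
    (hfG : ∀ n a, ‖f n a‖ ≤ ‖G a‖) (hlim : ∀ a, Tendsto (fun n => f n a) atTop (𝓝 0)) :
    Tendsto (fun n => eLpNorm (f n) 2 μ) atTop (𝓝 0) := by
  have h2 : (2 : ℝ≥0∞) ≠ 0 := two_ne_zero
  have h2' : (2 : ℝ≥0∞) ≠ ⊤ := ENNReal.ofNat_ne_top
  have h3 : (0 : ℝ) < (2 : ℝ≥0∞).toReal := by norm_num
  simp only [eLpNorm_eq_lintegral_rpow_enorm_toReal h2 h2']
  have hl : Tendsto (fun n => ∫⁻ a, ‖f n a‖ₑ ^ (2 : ℝ≥0∞).toReal ∂μ) atTop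
      (𝓝 (∫⁻ _, 0 ∂μ)) := by
    refine tendsto_lintegral_of_dominated_convergence' (fun a => ‖G a‖ₑ ^ (2 : ℝ≥0∞).toReal)
      (fun n => (hf n).enorm.pow_const _) (fun n => Eventually.of_forall fun a => ?_)
      (lintegral_rpow_enorm_lt_top_of_eLpNorm_lt_top h2 h2' hG.2).ne
      (Eventually.of_forall fun a => ?_)
    · exact ENNReal.rpow_le_rpow (enorm_le_iff_norm_le.2 (hfG n a)) h3.le
    · have := ((hlim a).enorm).ennrpow_const (2 : ℝ≥0∞).toReal
      simpa [ENNReal.zero_rpow_of_pos h3] using this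
  rw [lintegral_zero] at hl
  have := hl.ennrpow_const (1 / (2 : ℝ≥0∞).toReal)
  simpa using this

/-- The bound `‖W (A - l - iε)⁻¹‖ ≤ c`, uniformly in `l`. -/
def ResolventBound (W A : H →ₗ.[ℂ] H) (ε c : ℝ) : Prop :=
  ∀ (l : ℝ) (x : H), ‖evalOp W (resolvent A (l + ε * Complex.I) x)‖ ≤ c * ‖x‖

lemma add_mul_I_im_ne {ε : ℝ} (hε : 0 < ε) (l : ℝ) :
    ((l : ℂ) + ε * Complex.I).im ≠ 0 := by
  simpa using hε.ne'

section SelfAdjoint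

variable {A W : H →ₗ.[ℂ] H} (hA : IsSelfAdjoint A)

include hA

/-- The constant `c` is the supremum over the line `Im z = ε`, the side on which the forward Duhamel
integral converges; homogeneity passes from the unit ball to all vectors. -/
lemma exists_resolventBound (hdom : A.domain ≤ W.domain) (h : IsSmallPerturbation W A) :
    ∃ ε c : ℝ, 0 < ε ∧ 0 ≤ c ∧ c < 1 ∧ ResolventBound W A ε c := by
  obtain ⟨ε, hε, -, hs⟩ := h
  set S := ⨆ l : ℝ, opENorm fun x => evalOp W (resolvent A (l + ε * Complex.I) x) with hS
  have hSt : S ≠ ⊤ := (hs.trans ENNReal.one_lt_top).ne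
  refine ⟨ε, S.toReal, hε, ENNReal.toReal_nonneg, ?_, fun l x => ?_⟩
  · rw [← ENNReal.toReal_one]
    exact (ENNReal.toReal_lt_toReal hSt ENNReal.one_ne_top).2 hs
  · have hmem : ∀ y, resolvent A (l + ε * Complex.I) y ∈ W.domain := fun y =>
      hdom (resolvent_mem hA (add_mul_I_im_ne hε l) y)
    have h1 : ∀ y : H, ‖y‖ ≤ 1 → ‖evalOp W (resolvent A (l + ε * Complex.I) y)‖ ≤ S.toReal := by
      intro y hy
      rw [← toReal_enorm]
      refine (ENNReal.toReal_le_toReal enorm_ne_top hSt).2 ?_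
      refine le_trans ?_ (le_iSup (fun l : ℝ => opENorm fun x =>
        evalOp W (resolvent A (l + ε * Complex.I) x)) l)
      exact le_iSup₂ (f := fun x (_ : x ∈ Metric.closedBall (0 : H) 1) =>
        ‖evalOp W (resolvent A (l + ε * Complex.I) x)‖ₑ) y (mem_closedBall_zero_iff.2 hy)
    rcases eq_or_ne x 0 with rfl | hx
    · rw [map_zero, norm_zero, mul_zero, evalOp_of_mem W.domain.zero_mem]
      have : (⟨0, W.domain.zero_mem⟩ : W.domain) = 0 := rfl
      rw [this, W.map_zero, norm_zero]
    · have hx' : (‖x‖ : ℂ) ≠ 0 := by simpa using hx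
      have h2 := h1 ((‖x‖ : ℂ)⁻¹ • x) (by rw [norm_smul]; simp [hx])
      rw [map_smul, evalOp_smul (hmem x), norm_smul, norm_inv, Complex.norm_real, norm_norm,
        inv_mul_le_iff₀ (norm_pos_iff.2 hx)] at h2
      linarith

variable {ε c : ℝ} (hdom : A.domain ≤ W.domain) (hε : 0 < ε) (hb : ResolventBound W A ε c)

include hdom hε hb

/-- The operators `W Jₙ` are bounded. -/
lemma exists_clm_eq_evalOp_mollifier :
    ∃ M : ℕ → H →L[ℂ] H, ∀ n x, M n x = evalOp W (mollifier A n x) := by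
  set z : ℂ := ((0 : ℝ) : ℂ) + ε * Complex.I with hz
  have hz0 : z.im ≠ 0 := add_mul_I_im_ne hε 0
  have hmem : ∀ y, resolvent A z y ∈ W.domain := fun y => hdom (resolvent_mem hA hz0 y)
  let R : H →L[ℂ] H := LinearMap.mkContinuous
    { toFun := fun x => evalOp W (resolvent A z x)
      map_add' := fun x y => by rw [map_add, evalOp_add (hmem x) (hmem y)]
      map_smul' := fun k x => by rw [map_smul, evalOp_smul (hmem x), RingHom.id_apply] } c (hb 0)
  have hR : ∀ x, R x = evalOp W (resolvent A z x) := fun x => rfl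
  -- With `w = i(n+1)`, the identity `R(w) = R(z) (1 + (w - z) R(w))` writes `W Jₙ` as the bounded
  -- operator `W R(z)` after another bounded operator.
  refine ⟨fun n => R ∘L ((-(((n + 1 : ℕ) : ℂ) * Complex.I)) •
    (1 + ((((n + 1 : ℕ) : ℂ) * Complex.I) - z) •
      resolvent A (((n + 1 : ℕ) : ℂ) * Complex.I))), fun n x => ?_⟩
  rw [ContinuousLinearMap.comp_apply, hR]
  congr 1
  have hn := natCast_mul_I_im_ne (Nat.succ_ne_zero n)
  have h := (resolvent_spec hA hz0).2 ⟨_, resolvent_mem hA hn x⟩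
  rw [apply_resolvent hA hn] at h
  simp only [mollifier, smul_apply, map_smul, add_apply, one_apply_eq_self]
  congr 1
  refine (congrArg (resolvent A z) ?_).trans h
  module

variable {a b : ℝ} {g : ℝ → H}

omit [CompleteSpace H] hA hε hb hdom in
lemma memLp_exp_smul_clm (S : H →L[ℂ] H) (hg : MemLp g 2) (hab : ∀ t ∉ Icc a b, g t = 0) :
    MemLp (fun t => Real.exp (-ε * t) • S (g t)) 2 := by
  refine (((S.comp_memLp' hg)).const_smul (Real.exp (|ε| * (|a| + |b|)))).mono ?_
    (Eventually.of_forall fun t => norm_exp_smul_le (g := fun t => S (g t))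
      (a := a) (b := b) ε (fun t ht => ?_) t)
  · exact (Continuous.aestronglyMeasurable (f := fun t : ℝ => Real.exp (-ε * t))
      (by fun_prop)).smul (S.comp_memLp' hg).1
  · simp [hab t ht]

/-- Smoothness of `W` along the free evolution, for data on the line. -/
theorem evalOp_duhamel (hWc : W.IsClosed) (hc : 0 ≤ c) (hg : MemLp g 2)
    (hab : ∀ t ∉ Icc a b, g t = 0) :
    (∀ᵐ t, expI A (-t) (∫ s in Iio t, g s) ∈ W.domain) ∧
    AEStronglyMeasurable (fun t => evalOp W (expI A (-t) (∫ s in Iio t, g s))) volume ∧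
    eLpNorm (fun t => Real.exp (-ε * t) • evalOp W (expI A (-t) (∫ s in Iio t, g s))) 2 volume ≤
      ENNReal.ofReal c * eLpNorm (fun t => Real.exp (-ε * t) • g t) 2 volume := by
  obtain ⟨M, hM⟩ := exists_clm_eq_evalOp_mollifier hA hdom hε hb
  set u : ℝ → H := fun t => expI A (-t) (∫ s in Iio t, g s) with hu
  have hg1 : Integrable g := integrable_of_memLp_two hg hab
  have hmemW : ∀ n x, mollifier A n x ∈ W.domain := fun n x => hdom (mollifier_mem hA n x)
  -- the two `L²` estimates
  have hMR : ∀ n (l : ℝ) (x : H), M n (resolvent A (l + ε * Complex.I) x) =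
      evalOp W (resolvent A (l + ε * Complex.I) (mollifier A n x)) := by
    intro n l x
    rw [hM]
    congr 1
    exact (congrArg (fun T : H →L[ℂ] H => T x)
      (commute_resolvent_mollifier hA (add_mul_I_im_ne hε l) n).eq).symm
  -- Because `Jₙ` commutes with the resolvent, `W Jₙ R = W R Jₙ` is dominated by `c Jₙ`, and `c Jₙ`
  -- commutes with the free evolution.
  have hest : ∀ n, eLpNorm (fun t => Real.exp (-ε * t) • M n (u t)) 2 volume ≤
      ENNReal.ofReal c * eLpNorm (fun t => Real.exp (-ε * t) • g t) 2 volume := by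
    intro n
    refine (eLpNorm_duhamel_le hA (M := M n) (N := (c : ℂ) • mollifier A n) hε (fun l x => ?_)
      (fun t x => ?_) hg hab).trans ?_
    · rw [hMR, smul_apply, norm_smul, Complex.norm_real, Real.norm_of_nonneg hc]
      exact hb _ _
    · rw [smul_apply, smul_apply, expI_smul hA, mollifier_expI hA]
    · refine (eLpNorm_le_mul_eLpNorm_of_ae_le_mul (Eventually.of_forall fun t => ?_) 2)
      rw [norm_smul, norm_smul, smul_apply, norm_smul, Complex.norm_real, Real.norm_of_nonneg hc,
        mul_left_comm]
      gcongr
      exact norm_mollifier_apply_le hA _ _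
  -- The same estimate for differences: as `Jₙ g → g` in weighted `L²`, it makes `W Jₙ u` a Cauchy
  -- sequence there.
  have hest2 : ∀ m n, eLpNorm (fun t => Real.exp (-ε * t) • M m (u t) -
      Real.exp (-ε * t) • M n (u t)) 2 volume ≤
      ENNReal.ofReal c * eLpNorm (fun t => Real.exp (-ε * t) • mollifier A m (g t) -
        Real.exp (-ε * t) • mollifier A n (g t)) 2 volume := by
    intro m n
    have h := eLpNorm_duhamel_le hA (M := M m - M n)
      (N := (c : ℂ) • (mollifier A m - mollifier A n)) hε (fun l x => ?_)
      (fun t x => ?_) hg hab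
    · simp only [← smul_sub, ← sub_apply]
      refine h.trans (eLpNorm_le_mul_eLpNorm_of_ae_le_mul (Eventually.of_forall fun t => ?_) 2)
      rw [norm_smul, norm_smul, smul_apply, norm_smul, Complex.norm_real, Real.norm_of_nonneg hc,
        mul_left_comm]
    · have h1 : (M m - M n) (resolvent A (l + ε * Complex.I) x) =
          evalOp W (resolvent A (l + ε * Complex.I) ((mollifier A m - mollifier A n) x)) := by
        have hd : ∀ y, resolvent A (l + ε * Complex.I) y ∈ W.domain := fun y =>
          hdom (resolvent_mem hA (add_mul_I_im_ne hε l) y)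
        rw [sub_apply, hMR, hMR, sub_apply, map_sub, sub_eq_add_neg, sub_eq_add_neg,
          ← neg_one_smul ℂ (resolvent A _ (mollifier A n x)), evalOp_add (hd _)
          (W.domain.smul_mem _ (hd _)), evalOp_smul (hd _), neg_one_smul]
      rw [h1, smul_apply, norm_smul, Complex.norm_real, Real.norm_of_nonneg hc]
      exact hb _ _
    · simp only [smul_apply, sub_apply, expI_smul hA, expI_sub hA, mollifier_expI hA]
  -- convergence in `L²`
  have hu_lp : MemLp (fun t => Real.exp (-ε * t) • u t) 2 := memLp_duhamel hA hε hg1 hab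
  have hv_lp : ∀ n, MemLp (fun t => Real.exp (-ε * t) • M n (u t)) 2 := by
    intro n
    have h := (M n).comp_memLp' hu_lp
    refine h.ae_eq (Eventually.of_forall fun t => ?_)
    simp only [Function.comp_apply]
    rw [← Complex.coe_smul, ← Complex.coe_smul, map_smul]
  have hj_lp : ∀ n, MemLp (fun t => Real.exp (-ε * t) • mollifier A n (g t)) 2 := fun n =>
    memLp_exp_smul_clm (mollifier A n) hg hab
  have hg_lp : MemLp (fun t => Real.exp (-ε * t) • g t) 2 := by
    simpa using memLp_exp_smul_clm (1 : H →L[ℂ] H) hg hab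
  let v : ℕ → Lp H 2 (volume : Measure ℝ) := fun n => (hv_lp n).toLp _
  let j : ℕ → Lp H 2 (volume : Measure ℝ) := fun n => (hj_lp n).toLp _
  have hj : CauchySeq j := by
    refine Tendsto.cauchySeq (x := hg_lp.toLp _) ?_
    rw [Lp.tendsto_Lp_iff_tendsto_eLpNorm'']
    refine tendsto_eLpNorm_two_of_dominated (fun n => ((hj_lp n).sub hg_lp).1)
      (hg_lp.const_smul (2 : ℝ)) (fun n t => ?_) (fun t => ?_)
    · simp only [Pi.sub_apply, Pi.smul_apply]
      rw [← smul_sub, norm_smul, norm_smul, norm_smul, mul_left_comm]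
      gcongr
      rw [Real.norm_ofNat]
      calc _ ≤ ‖mollifier A n (g t)‖ + ‖g t‖ := norm_sub_le _ _
        _ ≤ 2 * ‖g t‖ := by linarith [norm_mollifier_apply_le hA n (g t)]
    · have h1 := ((tendsto_mollifier hA (g t)).sub_const (g t)).const_smul (Real.exp (-ε * t))
      simpa [smul_sub] using h1
  have hdist : ∀ m n, dist (v m) (v n) ≤ c * dist (j m) (j n) := by
    intro m n
    have h := hest2 m n
    rw [dist_eq_norm, dist_eq_norm, ← MemLp.toLp_sub, ← MemLp.toLp_sub, Lp.norm_toLp, Lp.norm_toLp,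
      ← ENNReal.toReal_ofReal hc, ← ENNReal.toReal_mul]
    exact ENNReal.toReal_mono
      (ENNReal.mul_ne_top ENNReal.ofReal_ne_top ((hj_lp m).sub (hj_lp n)).2.ne) h
  have hv : CauchySeq v := by
    rw [Metric.cauchySeq_iff]
    intro δ hδ
    obtain ⟨N, hN⟩ := Metric.cauchySeq_iff.1 hj (δ / (c + 1)) (by positivity)
    refine ⟨N, fun m hm n hn => (hdist m n).trans_lt ?_⟩
    calc c * dist (j m) (j n) ≤ (c + 1) * dist (j m) (j n) := by gcongr; linarith
      _ < (c + 1) * (δ / (c + 1)) := by gcongr; exact hN m hm n hn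
      _ = δ := by field_simp
  obtain ⟨V, hV⟩ := cauchySeq_tendsto_of_complete hv
  -- Along a subsequence `W Jₙ u(t)` converges for almost every `t`, while `Jₙ u(t) → u(t)`;
  -- closedness of `W` then puts `u(t)` in its domain and identifies the limit.
  obtain ⟨ns, hns, hae⟩ := (tendstoInMeasure_of_tendsto_Lp hV).exists_seq_tendsto_ae
  have hkey : ∀ᵐ t, u t ∈ W.domain ∧ evalOp W (u t) = Real.exp (ε * t) • V t := by
    have hall : ∀ᵐ t, ∀ n, v n t = Real.exp (-ε * t) • M n (u t) :=
      ae_all_iff.2 fun n => (hv_lp n).coeFn_toLp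
    filter_upwards [hae, hall] with t ht hall
    refine evalOp_of_tendsto hWc (x := fun n => mollifier A (ns n) (u t)) (fun n => hmemW _ _)
      ((tendsto_mollifier hA (u t)).comp hns.tendsto_atTop) ?_
    refine (ht.const_smul (Real.exp (ε * t))).congr fun n => ?_
    rw [hall, smul_smul, ← Real.exp_add, ← hM]
    simp
  have hkey2 : (fun t => Real.exp (-ε * t) • evalOp W (u t)) =ᵐ[volume] V := by
    filter_upwards [hkey] with t ht
    rw [ht.2, smul_smul, ← Real.exp_add]
    simp
  refine ⟨hkey.mono fun t ht => ht.1, ?_, ?_⟩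
  · refine AEStronglyMeasurable.congr (f := fun t => Real.exp (ε * t) • V t) ?_
      (hkey.mono fun t ht => ht.2.symm)
    exact (Continuous.aestronglyMeasurable (f := fun t : ℝ => Real.exp (ε * t))
      (by fun_prop)).smul (Lp.aestronglyMeasurable V)
  · rw [eLpNorm_congr_ae hkey2, ← Lp.enorm_def]
    refine le_of_tendsto hV.enorm (Eventually.of_forall fun n => ?_)
    rw [Lp.enorm_toLp]
    exact hest n

end SelfAdjoint

/-! ### The `L²` norm on `(0, T)` and exponential weights -/

section L2

variable {T : ℝ}

omit [InnerProductSpace ℂ H] [CompleteSpace H]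

/-- The norm of `L²(I, H)`. -/
def l2 (T : ℝ) (f : ℝ → H) : ℝ := (eLpNorm f 2 (volI T)).toReal

lemma l2_nonneg (f : ℝ → H) : 0 ≤ l2 T f := ENNReal.toReal_nonneg

lemma l2_congr {f g : ℝ → H} (h : f =ᵐ[volI T] g) : l2 T f = l2 T g := by
  rw [l2, l2, eLpNorm_congr_ae h]

lemma norm_toLp_eq_l2 {f : ℝ → H} (hf : MemLp f 2 (volI T)) : ‖hf.toLp f‖ = l2 T f :=
  Lp.norm_toLp f hf

lemma l2_add_le {f g : ℝ → H} (hf : MemLp f 2 (volI T)) (hg : MemLp g 2 (volI T)) :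
    l2 T (fun t => f t + g t) ≤ l2 T f + l2 T g := by
  rw [l2, l2, l2, ← ENNReal.toReal_add hf.2.ne hg.2.ne]
  exact ENNReal.toReal_mono (ENNReal.add_ne_top.2 ⟨hf.2.ne, hg.2.ne⟩)
    (eLpNorm_add_le hf.1 hg.1 one_le_two)

lemma l2_le_mul {f g : ℝ → H} {C : ℝ} (hC : 0 ≤ C) (hg : MemLp g 2 (volI T))
    (h : ∀ t ∈ Ioo 0 T, ‖f t‖ ≤ C * ‖g t‖) : l2 T f ≤ C * l2 T g := by
  rw [l2, l2, ← ENNReal.toReal_ofReal hC, ← ENNReal.toReal_mul]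
  exact ENNReal.toReal_mono (ENNReal.mul_ne_top ENNReal.ofReal_ne_top hg.2.ne)
    (eLpNorm_le_mul_eLpNorm_of_ae_le_mul
      ((ae_restrict_mem measurableSet_Ioo).mono fun t ht => h t ht) 2)

lemma l2_le {f g : ℝ → H} (hg : MemLp g 2 (volI T))
    (h : ∀ t ∈ Ioo 0 T, ‖f t‖ ≤ ‖g t‖) : l2 T f ≤ l2 T g := by
  simpa using l2_le_mul zero_le_one hg (by simpa using h)

lemma measure_volI_univ (T : ℝ) : volI T univ = ENNReal.ofReal T := by
  simp

lemma l2_le_of_bound (hT : 0 < T) {f : ℝ → H} {C : ℝ} (hC : 0 ≤ C)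
    (h : ∀ t ∈ Ioo 0 T, ‖f t‖ ≤ C) : l2 T f ≤ √T * C := by
  have h1 := eLpNorm_le_of_ae_bound (p := 2) (μ := volI T)
    ((ae_restrict_mem measurableSet_Ioo).mono fun t ht => h t ht)
  rw [measure_volI_univ] at h1
  have h2 := ENNReal.toReal_mono (ENNReal.mul_ne_top
    (ENNReal.rpow_ne_top_of_nonneg (by positivity) ENNReal.ofReal_ne_top) ENNReal.ofReal_ne_top) h1
  rw [ENNReal.toReal_mul, ← ENNReal.toReal_rpow, ENNReal.toReal_ofReal hT.le,
    ENNReal.toReal_ofReal hC] at h2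
  rw [Real.sqrt_eq_rpow, l2]
  simpa using h2

lemma setIntegral_norm_le (hT : 0 < T) {f : ℝ → H} (hf : MemLp f 2 (volI T)) :
    ∫ t, ‖f t‖ ∂(volI T) ≤ √T * l2 T f := by
  have h1 := eLpNorm_le_eLpNorm_mul_rpow_measure_univ (p := 1) (q := 2) one_le_two hf.1
  rw [measure_volI_univ] at h1
  have h2 := ENNReal.toReal_mono (ENNReal.mul_ne_top hf.2.ne
    (ENNReal.rpow_ne_top_of_nonneg (by norm_num) ENNReal.ofReal_ne_top)) h1
  rw [ENNReal.toReal_mul, ← ENNReal.toReal_rpow, ENNReal.toReal_ofReal hT.le] at h2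
  rw [integral_norm_eq_lintegral_enorm hf.1, ← eLpNorm_one_eq_lintegral_enorm, l2,
    Real.sqrt_eq_rpow, mul_comm]
  convert h2 using 3
  norm_num

lemma setIntegral_norm_sq_eq {f : ℝ → H} (hf : MemLp f 2 (volI T)) :
    ∫ t, ‖f t‖ ^ 2 ∂(volI T) = l2 T f ^ 2 := by
  have h := hf.eLpNorm_eq_integral_rpow_norm two_ne_zero ENNReal.ofNat_ne_top
  rw [l2, h, ENNReal.toReal_ofReal (by positivity)]
  simp only [ENNReal.toReal_ofNat, Real.rpow_two]
  rw [← Real.rpow_two, ← Real.rpow_mul (integral_nonneg fun _ => by positivity)]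
  norm_num

variable [NormedSpace ℝ H]

/-- The function `f` with the weight `e^{-εt}`. -/
def wt (ε : ℝ) (f : ℝ → H) (t : ℝ) : H := Real.exp (-ε * t) • f t

lemma norm_wt (ε : ℝ) (f : ℝ → H) (t : ℝ) : ‖wt ε f t‖ = Real.exp (-ε * t) * ‖f t‖ := by
  rw [wt, norm_smul, Real.norm_eq_abs, Real.abs_exp]

lemma wt_wt (ε δ : ℝ) (f : ℝ → H) : wt ε (wt δ f) = wt (ε + δ) f := by
  funext t
  rw [wt, wt, wt, smul_smul, ← Real.exp_add]
  ring_nf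

lemma norm_wt_le {ε : ℝ} {f : ℝ → H} {t : ℝ} (ht : t ∈ Ioo 0 T) :
    ‖wt ε f t‖ ≤ Real.exp (|ε| * T) * ‖f t‖ := by
  rw [norm_wt]
  refine mul_le_mul_of_nonneg_right (Real.exp_le_exp.2 ?_) (norm_nonneg _)
  exact (mul_le_mul_of_nonneg_right (neg_le_abs ε) ht.1.le).trans
    (mul_le_mul_of_nonneg_left ht.2.le (abs_nonneg ε))

lemma memLp_wt {ε : ℝ} {f : ℝ → H} {p : ℝ≥0∞} (hf : MemLp f p (volI T)) :
    MemLp (wt ε f) p (volI T) := by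
  refine MemLp.of_le_mul (c := Real.exp (|ε| * T)) hf ?_
    ((ae_restrict_mem measurableSet_Ioo).mono fun t ht => norm_wt_le ht)
  exact (Continuous.aestronglyMeasurable (f := fun t : ℝ => Real.exp (-ε * t))
      (by fun_prop)).smul hf.1

lemma memLp_of_wt {ε : ℝ} {f : ℝ → H} {p : ℝ≥0∞} (hf : MemLp (wt ε f) p (volI T)) :
    MemLp f p (volI T) := by
  have h := memLp_wt (ε := -ε) hf
  rw [wt_wt, neg_add_cancel] at h
  refine h.ae_eq (Eventually.of_forall fun t => ?_)
  simp [wt]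

lemma l2_wt_le {ε : ℝ} (hε : 0 < ε) {f : ℝ → H} (hf : MemLp f 2 (volI T)) :
    l2 T (wt ε f) ≤ l2 T f := by
  refine l2_le hf fun t ht => ?_
  rw [norm_wt]
  refine mul_le_of_le_one_left (norm_nonneg _) (Real.exp_le_one_iff.2 ?_)
  nlinarith [ht.1]

lemma l2_le_wt {ε : ℝ} (hε : 0 < ε) {f : ℝ → H} (hf : MemLp f 2 (volI T)) :
    l2 T f ≤ Real.exp (ε * T) * l2 T (wt ε f) := by
  refine l2_le_mul (Real.exp_nonneg _) (memLp_wt hf) fun t ht => ?_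
  rw [norm_wt, ← mul_assoc, ← Real.exp_add]
  refine le_mul_of_one_le_left (norm_nonneg _) (Real.one_le_exp ?_)
  nlinarith [ht.2]

end L2

/-! ### Smoothness of the perturbation along `H¹` paths -/

section Extension

variable {T : ℝ}

/-- The derivative of an extension of `w₀ + ∫₀ᵗ g` that vanishes before time `-1`. -/
def extDeriv (T : ℝ) (w₀ : H) (g : ℝ → H) : ℝ → H :=
  (Ioo 0 T).indicator g + (Icc (-1) 0).indicator fun _ => w₀

omit [InnerProductSpace ℂ H] [CompleteSpace H] in
lemma extDeriv_eq_zero (hT : 0 < T) (w₀ : H) (g : ℝ → H) :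
    ∀ t ∉ Icc (-1) T, extDeriv T w₀ g t = 0 := by
  intro t ht
  rw [extDeriv, Pi.add_apply, indicator_of_notMem, indicator_of_notMem, add_zero]
  · exact fun h => ht ⟨h.1, h.2.trans hT.le⟩
  · exact fun h => ht ⟨by linarith [h.1], h.2.le⟩

omit [InnerProductSpace ℂ H] [CompleteSpace H] in
lemma memLp_indicator_extDeriv {g : ℝ → H} (hg : MemLp g 2 (volI T)) :
    MemLp ((Ioo 0 T).indicator g) 2 :=
  (memLp_indicator_iff_restrict measurableSet_Ioo).2 hg

omit [InnerProductSpace ℂ H] [CompleteSpace H] in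
lemma memLp_indicator_const_extDeriv (w₀ : H) :
    MemLp ((Icc (-1 : ℝ) 0).indicator fun _ => w₀) 2 :=
  memLp_indicator_const 2 measurableSet_Icc w₀ (Or.inr (by simp))

omit [InnerProductSpace ℂ H] [CompleteSpace H] in
lemma memLp_extDeriv (w₀ : H) {g : ℝ → H} (hg : MemLp g 2 (volI T)) :
    MemLp (extDeriv T w₀ g) 2 :=
  (memLp_indicator_extDeriv hg).add (memLp_indicator_const_extDeriv w₀)

lemma setIntegral_extDeriv (w₀ : H) {g : ℝ → H} (hg : MemLp g 2 (volI T))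
    {t : ℝ} (ht : t ∈ Ioo 0 T) : ∫ s in Iio t, extDeriv T w₀ g s = prim w₀ g t := by
  have h1 : Integrable ((Ioo 0 T).indicator g) (volume.restrict (Iio t)) :=
    ((integrable_indicator_iff measurableSet_Ioo).2 (integrableOn_of_memLp hg)).restrict
  have h2 : Integrable ((Icc (-1 : ℝ) 0).indicator fun _ => w₀) (volume.restrict (Iio t)) :=
    ((integrable_indicator_iff measurableSet_Icc).2 (by simp [integrableOn_const_iff])).restrict
  have e1 : Ioo 0 T ∩ Iio t = Ioo 0 t := by
    ext s
    simp only [mem_inter_iff, mem_Ioo, mem_Iio]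
    exact ⟨fun h => ⟨h.1.1, h.2⟩, fun h => ⟨⟨h.1, h.2.trans ht.2⟩, h.2⟩⟩
  have e2 : Icc (-1) 0 ∩ Iio t = Icc (-1) 0 :=
    inter_eq_left.2 fun s hs => lt_of_le_of_lt hs.2 ht.1
  simp only [extDeriv, Pi.add_apply]
  rw [integral_add h1 h2, integral_indicator measurableSet_Ioo,
    integral_indicator measurableSet_Icc, Measure.restrict_restrict measurableSet_Ioo,
    Measure.restrict_restrict measurableSet_Icc, e1, e2, prim,
    intervalIntegral.integral_of_le ht.1.le, integral_Ioc_eq_integral_Ioo, add_comm]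
  simp

omit [CompleteSpace H] in
-- The added piece lives on `[-1, 0]`, of length one, where the weight is at most `e^ε`.
lemma eLpNorm_wt_extDeriv_le {ε : ℝ} (hε : 0 < ε) (w₀ : H) {g : ℝ → H} (hg : MemLp g 2 (volI T)) :
    eLpNorm (fun t => Real.exp (-ε * t) • extDeriv T w₀ g t) 2 volume ≤
      ENNReal.ofReal (l2 T (wt ε g) + Real.exp ε * ‖w₀‖) := by
  have hexp : ∀ s : Set ℝ, ∀ f : ℝ → H, (fun t => Real.exp (-ε * t) • s.indicator f t) =
      s.indicator (wt ε f) := by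
    intro s f
    funext t
    by_cases ht : t ∈ s
    · rw [indicator_of_mem ht, indicator_of_mem ht, wt]
    · rw [indicator_of_notMem ht, indicator_of_notMem ht, smul_zero]
  have hsplit : (fun t => Real.exp (-ε * t) • extDeriv T w₀ g t) =
      (Ioo 0 T).indicator (wt ε g) + (Icc (-1) 0).indicator (wt ε fun _ => w₀) := by
    rw [← hexp, ← hexp]
    funext t
    simp only [extDeriv, Pi.add_apply, smul_add]
  have hm1 : MemLp ((Ioo 0 T).indicator (wt ε g)) 2 := memLp_indicator_extDeriv (memLp_wt hg)
  have hc : Continuous (wt ε fun _ => w₀) := by unfold wt; fun_prop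
  rw [hsplit, ENNReal.ofReal_add (l2_nonneg _) (by positivity)]
  refine (eLpNorm_add_le hm1.1 (hc.aestronglyMeasurable.indicator measurableSet_Icc)
    one_le_two).trans ?_
  gcongr
  · rw [eLpNorm_indicator_eq_eLpNorm_restrict measurableSet_Ioo, l2,
      ENNReal.ofReal_toReal (memLp_wt hg).2.ne]
  · rw [eLpNorm_indicator_eq_eLpNorm_restrict measurableSet_Icc]
    have h1 := eLpNorm_le_of_ae_bound (p := 2) (μ := volume.restrict (Icc (-1 : ℝ) 0))
      (f := wt ε fun _ => w₀) (C := Real.exp ε * ‖w₀‖)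
      ((ae_restrict_mem measurableSet_Icc).mono fun t ht => by
        rw [norm_wt]
        gcongr
        nlinarith [ht.1])
    simpa using h1

variable {A W : H →ₗ.[ℂ] H}

/-- Smoothness of `W` along the free evolution of `H¹` paths. -/
theorem evalOp_prim (hA : IsSelfAdjoint A) (hT : 0 < T) {ε c : ℝ} (hdom : A.domain ≤ W.domain)
    (hε : 0 < ε)
    (hb : ResolventBound W A ε c) (hWc : W.IsClosed) (hc : 0 ≤ c) (w₀ : H) {g : ℝ → H}
    (hg : MemLp g 2 (volI T)) :
    (∀ᵐ t ∂(volI T), expI A (-t) (prim w₀ g t) ∈ W.domain) ∧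
    MemLp (fun t => evalOp W (expI A (-t) (prim w₀ g t))) 2 (volI T) ∧
    l2 T (wt ε fun t => evalOp W (expI A (-t) (prim w₀ g t))) ≤
      c * (l2 T (wt ε g) + Real.exp ε * ‖w₀‖) := by
  -- The estimate on the line is applied to the extended path, which agrees with the given one on
  -- `(0, T)`; restriction only decreases the norm.
  obtain ⟨h1, h2, h3⟩ := evalOp_duhamel hA hdom hε hb hWc hc (memLp_extDeriv w₀ hg)
    (extDeriv_eq_zero hT w₀ g)
  have heq : ∀ t ∈ Ioo 0 T, evalOp W (expI A (-t) (∫ s in Iio t, extDeriv T w₀ g s)) =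
      evalOp W (expI A (-t) (prim w₀ g t)) := fun t ht => by
    rw [setIntegral_extDeriv w₀ hg ht]
  have heq' : (wt ε fun t => evalOp W (expI A (-t) (∫ s in Iio t, extDeriv T w₀ g s)))
      =ᵐ[volI T] wt ε fun t => evalOp W (expI A (-t) (prim w₀ g t)) :=
    (ae_restrict_mem measurableSet_Ioo).mono fun t ht => by
      simp only [wt]; rw [heq t ht]
  have h4 : eLpNorm (wt ε fun t => evalOp W (expI A (-t) (prim w₀ g t))) 2 (volI T) ≤
      ENNReal.ofReal (c * (l2 T (wt ε g) + Real.exp ε * ‖w₀‖)) := by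
    rw [← eLpNorm_congr_ae heq', ENNReal.ofReal_mul hc]
    refine ((eLpNorm_mono_measure _ Measure.restrict_le_self).trans h3).trans ?_
    gcongr
    exact eLpNorm_wt_extDeriv_le hε w₀ hg
  have h5 : AEStronglyMeasurable (fun t => evalOp W (expI A (-t) (prim w₀ g t))) (volI T) :=
    h2.restrict.congr ((ae_restrict_mem measurableSet_Ioo).mono heq)
  refine ⟨?_, memLp_of_wt (ε := ε) ⟨?_, h4.trans_lt ENNReal.ofReal_lt_top⟩, ?_⟩
  · filter_upwards [ae_restrict_of_ae h1, ae_restrict_mem measurableSet_Ioo] with t ht hm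
    rwa [setIntegral_extDeriv w₀ hg hm] at ht
  · exact (Continuous.aestronglyMeasurable (f := fun t : ℝ => Real.exp (-ε * t))
      (by fun_prop)).smul h5
  · rw [l2]
    refine (ENNReal.toReal_mono ENNReal.ofReal_ne_top h4).trans_eq (ENNReal.toReal_ofReal ?_)
    have := l2_nonneg (T := T) (wt ε g)
    positivity

end Extension

/-! ### The residual as a bounded operator -/

section Prim

variable {T : ℝ}

omit [CompleteSpace H] in
lemma prim_congr {w₀ : H} {g g' : ℝ → H} (h : g =ᵐ[volI T] g') {t : ℝ} (ht : t ∈ Icc 0 T) :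
    prim w₀ g t = prim w₀ g' t := by
  rw [prim, prim, intervalIntegral.integral_of_le ht.1, intervalIntegral.integral_of_le ht.1,
    integral_Ioc_eq_integral_Ioo, integral_Ioc_eq_integral_Ioo]
  congr 1
  exact integral_congr_ae (ae_mono (Measure.restrict_mono (Ioo_subset_Ioo_right ht.2) le_rfl) h)

omit [CompleteSpace H] in
lemma prim_add (hT : 0 < T) (w₀ w₁ : H) {g g' : ℝ → H} (hg : MemLp g 2 (volI T))
    (hg' : MemLp g' 2 (volI T)) {t : ℝ} (ht : t ∈ Icc 0 T) :
    prim (w₀ + w₁) (fun s => g s + g' s) t = prim w₀ g t + prim w₁ g' t := by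
  rw [prim, prim, prim, intervalIntegral.integral_add (intervalIntegrable_of_memLp' hT hg ht)
    (intervalIntegrable_of_memLp' hT hg' ht)]
  abel

omit [CompleteSpace H] in
lemma prim_smul (k : ℂ) (w₀ : H) (g : ℝ → H) (t : ℝ) :
    prim (k • w₀) (fun s => k • g s) t = k • prim w₀ g t := by
  rw [prim, prim, intervalIntegral.integral_smul, smul_add]

omit [CompleteSpace H] in
lemma norm_prim_le (hT : 0 < T) (w₀ : H) {g : ℝ → H} (hg : MemLp g 2 (volI T)) {t : ℝ}
    (ht : t ∈ Icc 0 T) : ‖prim w₀ g t‖ ≤ ‖w₀‖ + √T * l2 T g := by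
  refine (norm_add_le _ _).trans (add_le_add_right ?_ _)
  rw [intervalIntegral.integral_of_le ht.1, integral_Ioc_eq_integral_Ioo]
  refine (norm_integral_le_integral_norm _).trans (le_trans ?_ (setIntegral_norm_le hT hg))
  exact setIntegral_mono_set (integrableOn_of_memLp hg).norm
    (Eventually.of_forall fun _ => norm_nonneg _) (Ioo_subset_Ioo_right ht.2).eventuallyLE

end Prim

/-- The standing assumptions on the operators. -/
structure Admissible (T : ℝ) (A W : H →ₗ.[ℂ] H) (B : ℝ → H →L[ℂ] H) : Prop where
  pos : 0 < T
  selfAdjoint : IsSelfAdjoint A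
  closed : W.IsClosed
  symm : W.IsFormalAdjoint W
  domain_le : A.domain ≤ W.domain
  small : IsSmallPerturbation W A
  bdd_selfAdjoint : ∀ t ∈ Ioo 0 T, IsSelfAdjoint (B t)
  bdd_cont : ∀ x : H, ContinuousOn (fun t => B t x) (Ioo 0 T)
  bdd : ∃ C : ℝ, ∀ t ∈ Ioo 0 T, ‖B t‖ ≤ C

/-- The residual of the path `w₀ + ∫₀ᵗ g`. -/
def resid (A W : H →ₗ.[ℂ] H) (B : ℝ → H →L[ℂ] H) (w₀ : H) (g : ℝ → H) (t : ℝ) : H :=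
  Complex.I • g t - expI A t (evalOp W (expI A (-t) (prim w₀ g t)) +
    B t (expI A (-t) (prim w₀ g t)))

omit [CompleteSpace H] in
-- Split `B r (v r)` as `B r (v r - v t) + B r (v t)`: the uniform bound handles the first term,
-- strong continuity the second.
lemma continuousOn_clm_apply {B : ℝ → H →L[ℂ] H} {s : Set ℝ} {C : ℝ}
    (hB : ∀ x : H, ContinuousOn (fun t => B t x) s) (hC : ∀ t ∈ s, ‖B t‖ ≤ C) {v : ℝ → H}
    (hv : ContinuousOn v s) : ContinuousOn (fun t => B t (v t)) s := by
  intro t ht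
  have h1 : Tendsto (fun r => B r (v r - v t)) (𝓝[s] t) (𝓝 0) := by
    refine squeeze_zero_norm' (a := fun r => C * ‖v r - v t‖)
      (eventually_nhdsWithin_of_forall fun r hr => (B r).le_of_opNorm_le (hC r hr) _) ?_
    have := ((hv t ht).sub_const (v t)).norm.const_mul C
    simpa using this
  have h2 := h1.add (hB (v t) t ht)
  rw [zero_add] at h2
  refine h2.congr fun r => ?_
  rw [← map_add, sub_add_cancel]

variable {T : ℝ} {A W : H →ₗ.[ℂ] H} {B : ℝ → H →L[ℂ] H}

namespace Admissible

variable (h : Admissible T A W B)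

include h

lemma continuousOn_expI_prim (w₀ : H) {g : ℝ → H} (hg : MemLp g 2 (volI T)) :
    ContinuousOn (fun t => expI A (-t) (prim w₀ g t)) (Icc 0 T) :=
  (continuous_expI h.selfAdjoint).comp_continuousOn
    (continuous_neg.continuousOn.prodMk (continuousOn_prim h.pos w₀ hg))

lemma memLp_bdd (w₀ : H) {g : ℝ → H} (hg : MemLp g 2 (volI T)) :
    MemLp (fun t => B t (expI A (-t) (prim w₀ g t))) 2 (volI T) := by
  obtain ⟨C, hC⟩ := h.bdd
  have hu := h.continuousOn_expI_prim w₀ hg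
  refine MemLp.of_le_mul (c := C) (memLp_of_continuousOn hu 2) ?_ ?_
  · exact (continuousOn_clm_apply h.bdd_cont hC
      (hu.mono Ioo_subset_Icc_self)).aestronglyMeasurable measurableSet_Ioo
  · exact (ae_restrict_mem measurableSet_Ioo).mono fun t ht => (B t).le_of_opNorm_le (hC t ht) _

lemma ae_mem_domain (w₀ : H) {g : ℝ → H} (hg : MemLp g 2 (volI T)) :
    ∀ᵐ t ∂(volI T), expI A (-t) (prim w₀ g t) ∈ W.domain := by
  obtain ⟨ε, c, hε, hc, -, hb⟩ := exists_resolventBound h.selfAdjoint h.domain_le h.small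
  exact (evalOp_prim h.selfAdjoint h.pos h.domain_le hε hb h.closed hc w₀ hg).1

lemma memLp_evalOp (w₀ : H) {g : ℝ → H} (hg : MemLp g 2 (volI T)) :
    MemLp (fun t => evalOp W (expI A (-t) (prim w₀ g t))) 2 (volI T) := by
  obtain ⟨ε, c, hε, hc, -, hb⟩ := exists_resolventBound h.selfAdjoint h.domain_le h.small
  exact (evalOp_prim h.selfAdjoint h.pos h.domain_le hε hb h.closed hc w₀ hg).2.1

lemma memLp_expI {f : ℝ → H} (hf : MemLp f 2 (volI T)) :
    MemLp (fun t => expI A t (f t)) 2 (volI T) :=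
  hf.mono (aestronglyMeasurable_expI h.selfAdjoint hf.1 continuous_id)
    (Eventually.of_forall fun _ => (norm_expI h.selfAdjoint _ _).le)

lemma memLp_resid (w₀ : H) {g : ℝ → H} (hg : MemLp g 2 (volI T)) :
    MemLp (resid A W B w₀ g) 2 (volI T) :=
  (hg.const_smul Complex.I).sub
    (h.memLp_expI ((h.memLp_evalOp w₀ hg).add (h.memLp_bdd w₀ hg)))

omit h in
lemma resid_congr {w₀ : H} {g g' : ℝ → H} (hgg : g =ᵐ[volI T] g') :
    resid A W B w₀ g =ᵐ[volI T] resid A W B w₀ g' := by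
  filter_upwards [hgg, ae_restrict_mem measurableSet_Ioo] with t ht hm
  rw [resid, resid, ht, prim_congr hgg (Ioo_subset_Icc_self hm)]

lemma resid_add (w₀ w₁ : H) {g g' : ℝ → H} (hg : MemLp g 2 (volI T)) (hg' : MemLp g' 2 (volI T)) :
    resid A W B (w₀ + w₁) (fun s => g s + g' s) =ᵐ[volI T]
      fun t => resid A W B w₀ g t + resid A W B w₁ g' t := by
  filter_upwards [h.ae_mem_domain w₀ hg, h.ae_mem_domain w₁ hg',
    ae_restrict_mem measurableSet_Ioo] with t h1 h2 hm
  simp only [resid]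
  rw [prim_add h.pos w₀ w₁ hg hg' (Ioo_subset_Icc_self hm),
    expI_add_apply h.selfAdjoint (-t), evalOp_add h1 h2, map_add, smul_add]
  simp only [expI_add_apply h.selfAdjoint]
  abel

lemma resid_smul (k : ℂ) (w₀ : H) {g : ℝ → H} (hg : MemLp g 2 (volI T)) :
    resid A W B (k • w₀) (fun s => k • g s) =ᵐ[volI T] fun t => k • resid A W B w₀ g t := by
  filter_upwards [h.ae_mem_domain w₀ hg] with t h1
  simp only [resid]
  rw [prim_smul, expI_smul h.selfAdjoint, evalOp_smul h1, map_smul, ← smul_add,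
    expI_smul h.selfAdjoint, smul_comm, smul_sub]

lemma l2_bdd_le {C m : ℝ} (hC : ∀ t ∈ Ioo 0 T, ‖B t‖ ≤ C) (w₀ : H) {g : ℝ → H}
    (hm : ∀ t ∈ Icc 0 T, ‖prim w₀ g t‖ ≤ m) :
    l2 T (fun t => B t (expI A (-t) (prim w₀ g t))) ≤ √T * (|C| * m) := by
  have hm0 : 0 ≤ m := (norm_nonneg _).trans (hm 0 (left_mem_Icc.2 h.pos.le))
  refine l2_le_of_bound h.pos (by positivity) fun t ht => ?_
  refine ((B t).le_of_opNorm_le ((hC t ht).trans (le_abs_self C)) _).trans ?_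
  rw [norm_expI h.selfAdjoint]
  gcongr
  exact hm t (Ioo_subset_Icc_self ht)

/-- Continuity of the residual. The `W` term is bounded in the weighted norm and the weight is
removed at the cost of `e^{εT}`; the `B` term is bounded through the supremum of the path. -/
lemma exists_l2_resid_le : ∃ K : ℝ, 0 ≤ K ∧ ∀ (w₀ : H) (g : ℝ → H), MemLp g 2 (volI T) →
    l2 T (resid A W B w₀ g) ≤ K * (‖w₀‖ + l2 T g) := by
  obtain ⟨ε, c, hε, hc, -, hb⟩ := exists_resolventBound h.selfAdjoint h.domain_le h.small
  obtain ⟨C, hC⟩ := h.bdd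
  refine ⟨1 + Real.exp (ε * T) * c * Real.exp ε + √T * |C| * (1 + √T), by positivity,
    fun w₀ g hg => ?_⟩
  obtain ⟨-, h1, h2⟩ := evalOp_prim h.selfAdjoint h.pos h.domain_le hε hb h.closed hc w₀ hg
  have h3 := h.memLp_bdd w₀ hg
  have h4 := h.l2_bdd_le hC w₀ fun t ht => norm_prim_le h.pos w₀ hg ht
  have h5 := l2_le_wt hε h1
  have h6 := l2_wt_le hε hg
  have hg0 : 0 ≤ l2 T g := l2_nonneg g
  have h7 : l2 T (resid A W B w₀ g) ≤ l2 T g + (l2 T (fun t => evalOp W (expI A (-t) (prim w₀ g t)))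
      + l2 T (fun t => B t (expI A (-t) (prim w₀ g t)))) := by
    have e1 : l2 T (fun t => Complex.I • g t) ≤ l2 T g :=
      l2_le hg fun t _ => by rw [norm_smul, Complex.norm_I, one_mul]
    have e2 : l2 T (fun t => -expI A t (evalOp W (expI A (-t) (prim w₀ g t)) +
        B t (expI A (-t) (prim w₀ g t)))) ≤ _ :=
      (l2_le (h1.add h3) fun t _ => by
        rw [norm_neg, norm_expI h.selfAdjoint]; rfl).trans (l2_add_le h1 h3)
    have e3 := l2_add_le (hg.const_smul Complex.I) (h.memLp_expI (h1.add h3)).neg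
    have e4 : l2 T (resid A W B w₀ g) ≤ _ := le_trans (le_of_eq (by
      refine l2_congr (Eventually.of_forall fun t => ?_)
      exact sub_eq_add_neg _ _)) e3
    exact e4.trans (add_le_add e1 e2)
  have he1 : 1 ≤ Real.exp ε := Real.one_le_exp hε.le
  have h8 : l2 T (fun t => evalOp W (expI A (-t) (prim w₀ g t))) ≤
      Real.exp (ε * T) * c * Real.exp ε * (‖w₀‖ + l2 T g) := by
    calc _ ≤ Real.exp (ε * T) * (c * (l2 T (wt ε g) + Real.exp ε * ‖w₀‖)) := by
          refine h5.trans ?_; gcongr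
      _ ≤ Real.exp (ε * T) * (c * (Real.exp ε * l2 T g + Real.exp ε * ‖w₀‖)) := by
          gcongr; exact h6.trans (le_mul_of_one_le_left hg0 he1)
      _ = _ := by ring
  have h9 : √T * (|C| * (‖w₀‖ + √T * l2 T g)) ≤ √T * |C| * (1 + √T) * (‖w₀‖ + l2 T g) := by
    have e : ‖w₀‖ + √T * l2 T g ≤ (1 + √T) * (‖w₀‖ + l2 T g) := by
      have := mul_nonneg (Real.sqrt_nonneg T) (norm_nonneg w₀)
      nlinarith
    calc √T * (|C| * (‖w₀‖ + √T * l2 T g)) ≤ √T * (|C| * ((1 + √T) * (‖w₀‖ + l2 T g))) := by gcongr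
      _ = _ := by ring
  have := norm_nonneg w₀
  nlinarith

/-! ### The energy estimate -/

/-- Since `e^{itA}` is unitary and `W`, `B(t)` are symmetric, their contributions to `⟪w, i g⟫` are
real. Only the residual enters the real part of `⟪w, g⟫`. -/
lemma re_inner_prim_le (w₀ : H) {g : ℝ → H} (hg : MemLp g 2 (volI T)) :
    ∀ᵐ t ∂(volI T), (⟪prim w₀ g t, g t⟫_ℂ).re ≤ ‖prim w₀ g t‖ * ‖resid A W B w₀ g t‖ := by
  filter_upwards [h.ae_mem_domain w₀ hg, ae_restrict_mem measurableSet_Ioo] with t hd ht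
  have hwu : prim w₀ g t = expI A t (expI A (-t) (prim w₀ g t)) :=
    (expI_apply_expI_neg h.selfAdjoint _ _).symm
  have hwu' : ∀ y, ⟪prim w₀ g t, expI A t y⟫_ℂ = ⟪expI A (-t) (prim w₀ g t), y⟫_ℂ := fun y =>
    (congrArg (fun v => ⟪v, expI A t y⟫_ℂ) hwu).trans (inner_expI h.selfAdjoint t _ _)
  have hgt : g t = -Complex.I • (resid A W B w₀ g t + expI A t
      (evalOp W (expI A (-t) (prim w₀ g t)) + B t (expI A (-t) (prim w₀ g t)))) := by
    rw [resid, sub_add_cancel, smul_smul]; simp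
  have him1 : (⟪expI A (-t) (prim w₀ g t), evalOp W (expI A (-t) (prim w₀ g t))⟫_ℂ).im = 0 := by
    rw [evalOp_of_mem hd]
    have h1 := h.symm ⟨_, hd⟩ ⟨_, hd⟩
    rw [← inner_conj_symm] at h1
    exact Complex.conj_eq_iff_im.1 h1
  have him2 : (⟪expI A (-t) (prim w₀ g t), B t (expI A (-t) (prim w₀ g t))⟫_ℂ).im = 0 := by
    have h1 := ContinuousLinearMap.isSelfAdjoint_iff_isSymmetric.1 (h.bdd_selfAdjoint t ht)
      (expI A (-t) (prim w₀ g t)) (expI A (-t) (prim w₀ g t))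
    simp only [ContinuousLinearMap.coe_coe] at h1
    rw [← inner_conj_symm] at h1
    exact Complex.conj_eq_iff_im.1 h1
  have hin : (⟪prim w₀ g t, g t⟫_ℂ).re = (⟪prim w₀ g t, resid A W B w₀ g t⟫_ℂ).im := by
    have h2 : ⟪prim w₀ g t, g t⟫_ℂ = -Complex.I * (⟪prim w₀ g t, resid A W B w₀ g t⟫_ℂ +
        (⟪expI A (-t) (prim w₀ g t), evalOp W (expI A (-t) (prim w₀ g t))⟫_ℂ +
          ⟪expI A (-t) (prim w₀ g t), B t (expI A (-t) (prim w₀ g t))⟫_ℂ)) := by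
      conv_lhs => rw [hgt]
      rw [inner_smul_right, inner_add_right, hwu', inner_add_right (expI A (-t) (prim w₀ g t))]
    rw [h2, neg_mul, Complex.neg_re, Complex.I_mul_re, neg_neg, Complex.add_im, Complex.add_im,
      him1, him2, add_zero, add_zero]
  rw [hin]
  exact (le_abs_self _).trans ((Complex.abs_im_le_norm _).trans (norm_inner_le_norm _ _))

/-- For continuous `g` the path is differentiable everywhere. Integrating the derivative of `‖w‖²`
up to the time where `‖w‖` takes its maximum `m` gives `m² ≤ ‖w₀‖² + 2 m √T ‖r‖`; as `‖w₀‖ ≤ m`, one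
may divide by `m`. -/
lemma norm_prim_le_of_continuous (w₀ : H) {g : ℝ → H} (hg : Continuous g) {t : ℝ}
    (ht : t ∈ Icc 0 T) :
    ‖prim w₀ g t‖ ≤ ‖w₀‖ + 2 * (√T * l2 T (resid A W B w₀ g)) := by
  have hT := h.pos
  have hgm : MemLp g 2 (volI T) := memLp_of_continuousOn hg.continuousOn 2
  have hr := h.memLp_resid w₀ hgm
  set r := resid A W B w₀ g with hrdef
  have hri : Integrable (fun s => ‖r s‖) (volI T) := (hr.integrable one_le_two).norm
  have hder : ∀ s, HasDerivAt (prim w₀ g) (g s) s := fun s =>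
    (intervalIntegral.integral_hasDerivAt_right (hg.intervalIntegrable _ _)
      (hg.stronglyMeasurableAtFilter _ _) hg.continuousAt).const_add w₀
  have hpc : Continuous (prim w₀ g) := continuous_iff_continuousAt.2 fun s => (hder s).continuousAt
  have hder2 : ∀ s, HasDerivAt (fun s => ‖prim w₀ g s‖ ^ 2) (2 * (⟪prim w₀ g s, g s⟫_ℂ).re) s := by
    intro s
    have h1 := (hder s).inner ℂ (hder s)
    have h2 := Complex.reCLM.hasFDerivAt.comp_hasDerivAt s h1
    simp only [Function.comp_def, Complex.reCLM_apply, Complex.add_re] at h2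
    have h3 : (⟪g s, prim w₀ g s⟫_ℂ).re = (⟪prim w₀ g s, g s⟫_ℂ).re := by
      rw [← inner_conj_symm, Complex.conj_re]
    rw [h3, ← two_mul] at h2
    refine h2.congr_of_eventuallyEq (Eventually.of_forall fun s => ?_)
    simp only
    rw [inner_self_eq_norm_sq_to_K]
    simp [← Complex.ofReal_pow]
  obtain ⟨τ, hτ, hmax⟩ := isCompact_Icc.exists_isMaxOn (nonempty_Icc.2 hT.le)
    hpc.norm.continuousOn
  set m := ‖prim w₀ g τ‖ with hm
  have hle : ∀ s ∈ Icc 0 T, ‖prim w₀ g s‖ ≤ m := fun s hs => hmax hs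
  have hcont : Continuous fun s => 2 * (⟪prim w₀ g s, g s⟫_ℂ).re :=
    continuous_const.mul (Complex.continuous_re.comp (hpc.inner hg))
  have hftc := intervalIntegral.integral_eq_sub_of_hasDerivAt (a := 0) (b := τ)
    (fun s _ => hder2 s) (hcont.intervalIntegrable _ _)
  have hsub : Ioo 0 τ ⊆ Ioo 0 T := Ioo_subset_Ioo_right hτ.2
  have hint : ∫ s in (0 : ℝ)..τ, 2 * (⟪prim w₀ g s, g s⟫_ℂ).re ≤ 2 * m * ∫ s, ‖r s‖ ∂(volI T) := by
    rw [intervalIntegral.integral_of_le hτ.1, integral_Ioc_eq_integral_Ioo, ← integral_const_mul]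
    refine le_trans (b := ∫ s in Ioo 0 τ, 2 * m * ‖r s‖) ?_ ?_
    · refine integral_mono_ae ((hcont.integrableOn_Icc (a := 0) (b := τ)).mono_set
        Ioo_subset_Icc_self) ((hri.const_mul (2 * m)).mono_measure
          (Measure.restrict_mono hsub le_rfl)) ?_
      have h1 := ae_mono (Measure.restrict_mono hsub le_rfl) (h.re_inner_prim_le w₀ hgm)
      filter_upwards [h1, ae_restrict_mem measurableSet_Ioo] with s hs hsm
      have h2 := hle s (Ioo_subset_Icc_self (hsub hsm))
      have h3 := mul_le_mul_of_nonneg_right h2 (norm_nonneg (r s))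
      rw [← hrdef] at hs
      linarith
    · exact setIntegral_mono_set (hri.const_mul (2 * m))
        (Eventually.of_forall fun _ => by positivity) hsub.eventuallyLE
  rw [hftc, prim_zero, ← hm] at hint
  have hr2 := setIntegral_norm_le hT hr
  have h0 : ‖w₀‖ ≤ m := by
    have := hle 0 (left_mem_Icc.2 hT.le)
    rwa [prim_zero] at this
  have hmb : m ≤ ‖w₀‖ + 2 * (√T * l2 T r) := by
    rcases (norm_nonneg (prim w₀ g τ)).eq_or_lt with h' | h'
    · rw [hm, ← h']
      have := l2_nonneg (T := T) r
      positivity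
    · rw [← hm] at h'
      have h4 := mul_le_mul_of_nonneg_left hr2 h'.le
      have h5 := mul_le_mul_of_nonneg_right h0 (norm_nonneg w₀)
      refine le_of_mul_le_mul_left ?_ h'
      nlinarith
  exact (hle t ht).trans hmb

end Admissible

/-! ### Minimization over weakly closed sets -/

section Weak

/-- Closed balls of a Hilbert space are weakly compact. -/
lemma isCompact_toWeakSpace_closedBall (r : ℝ) :
    IsCompact (toWeakSpace ℂ H '' Metric.closedBall 0 r) := by
  have hK := WeakDual.isCompact_closedBall (0 : StrongDual ℂ H) r
  let ψ : WeakDual ℂ H → WeakSpace ℂ H := fun f =>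
    toWeakSpace ℂ H ((InnerProductSpace.toDual ℂ H).symm (WeakDual.toStrongDual f))
  have hψ : Continuous ψ := by
    refine WeakBilin.continuous_of_continuous_eval _ fun l => ?_
    -- The Riesz isomorphism is conjugate linear, so testing the vector of `f` against `l` gives the
    -- conjugate of `f` at the vector of `l`, which is weak-* continuous in `f`.
    have h1 : ∀ f : WeakDual ℂ H, l ((InnerProductSpace.toDual ℂ H).symm (WeakDual.toStrongDual f)) =
        starRingEnd ℂ (f ((InnerProductSpace.toDual ℂ H).symm l)) := by
      intro f
      have e1 : l ((InnerProductSpace.toDual ℂ H).symm (WeakDual.toStrongDual f)) =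
          ⟪(InnerProductSpace.toDual ℂ H).symm l,
            (InnerProductSpace.toDual ℂ H).symm (WeakDual.toStrongDual f)⟫_ℂ :=
        InnerProductSpace.toDual_symm_apply.symm
      have e2 : f ((InnerProductSpace.toDual ℂ H).symm l) =
          ⟪(InnerProductSpace.toDual ℂ H).symm (WeakDual.toStrongDual f),
            (InnerProductSpace.toDual ℂ H).symm l⟫_ℂ :=
        (InnerProductSpace.toDual_symm_apply (y := WeakDual.toStrongDual f)).symm
      rw [e1, e2, inner_conj_symm]
    have h2 : Continuous fun f : WeakDual ℂ H =>
        starRingEnd ℂ (f ((InnerProductSpace.toDual ℂ H).symm l)) :=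
      Complex.continuous_conj.comp (WeakDual.eval_continuous _)
    exact h2.congr fun f => (h1 f).symm
  convert hK.image hψ using 1
  ext y
  constructor
  · rintro ⟨x, hx, rfl⟩
    refine ⟨StrongDual.toWeakDual (InnerProductSpace.toDual ℂ H x), ?_, ?_⟩
    · rw [mem_preimage, mem_closedBall_zero_iff] at *
      simpa using hx
    · exact congrArg (toWeakSpace ℂ H) ((InnerProductSpace.toDual ℂ H).symm_apply_apply x)
  · rintro ⟨f, hf, rfl⟩
    refine ⟨_, ?_, rfl⟩
    rw [mem_preimage, mem_closedBall_zero_iff] at hf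
    rw [mem_closedBall_zero_iff, LinearIsometryEquiv.norm_map]
    exact hf

omit [CompleteSpace H] in
/-- Convex continuous functions are weakly lower semicontinuous. -/
lemma lowerSemicontinuous_toWeakSpace_symm {F : H → ℝ} (hF : ConvexOn ℝ univ F)
    (hc : Continuous F) : LowerSemicontinuous fun y : WeakSpace ℂ H => F ((toWeakSpace ℂ H).symm y) := by
  rw [lowerSemicontinuous_iff_isClosed_preimage]
  intro a
  have h1 : Convex ℝ {x | F x ≤ a} := by simpa using hF.convex_le a
  have h2 : _root_.IsClosed {x | F x ≤ a} := isClosed_le hc continuous_const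
  have h3 := h1.toWeakSpace_closure ℂ
  rw [h2.closure_eq] at h3
  convert (isClosed_closure : _root_.IsClosed (closure (toWeakSpace ℂ H '' {x | F x ≤ a}))) using 1
  rw [← h3, LinearEquiv.image_eq_preimage_symm]
  rfl

/-- A coercive convex continuous function attains its minimum on every weakly closed set. -/
theorem exists_isMinOn_of_coercive {F : H → ℝ} (hF : ConvexOn ℝ univ F) (hc : Continuous F)
    (hcoer : ∀ a, ∃ r, ∀ x, F x ≤ a → ‖x‖ ≤ r) {Z : Set H} (hne : Z.Nonempty)
    (hZ : _root_.IsClosed (toWeakSpace ℂ H '' Z)) : ∃ v ∈ Z, IsMinOn F Z v := by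
  obtain ⟨z, hz⟩ := hne
  obtain ⟨r, hr⟩ := hcoer (F z)
  have hK : IsCompact (toWeakSpace ℂ H '' Metric.closedBall 0 r ∩ toWeakSpace ℂ H '' Z) :=
    (isCompact_toWeakSpace_closedBall r).inter_right hZ
  have hzr : z ∈ Metric.closedBall (0 : H) r := mem_closedBall_zero_iff.2 (hr z le_rfl)
  have hne : (toWeakSpace ℂ H '' Metric.closedBall 0 r ∩ toWeakSpace ℂ H '' Z).Nonempty :=
    ⟨toWeakSpace ℂ H z, mem_image_of_mem _ hzr, mem_image_of_mem _ hz⟩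
  obtain ⟨y, ⟨-, v, hv, rfl⟩, hy⟩ :=
    ((lowerSemicontinuous_toWeakSpace_symm hF hc).lowerSemicontinuousOn _).exists_isMinOn hne hK
  have hmin : ∀ x ∈ Z, ‖x‖ ≤ r → F v ≤ F x := fun x hx hxr => by
    have := hy ⟨mem_image_of_mem _ (mem_closedBall_zero_iff.2 hxr), mem_image_of_mem _ hx⟩
    simpa using this
  refine ⟨v, hv, fun x hx => ?_⟩
  -- Points with `F x ≤ F z` lie in the ball of radius `r`; for the others, compare with `z`.
  rcases le_total (F x) (F z) with hxz | hxz
  · exact hmin x hx (hr x hxz)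
  · exact (hmin z hz (hr z le_rfl)).trans hxz

lemma convexOn_norm_sub_sq {X Y : Type*} [NormedAddCommGroup X] [NormedSpace ℝ X]
    [NormedAddCommGroup Y] [NormedSpace ℝ Y] (L : X →L[ℝ] Y) (v : Y) :
    ConvexOn ℝ univ fun x => ‖L x - v‖ ^ 2 := by
  have h : ConvexOn ℝ univ fun x => ‖L x - v‖ := by
    refine ⟨convex_univ, fun x _ y _ a b ha hb hab => ?_⟩
    have e : L (a • x + b • y) - v = a • (L x - v) + b • (L y - v) := by
      have hv : v = a • v + b • v := by rw [← add_smul, hab, one_smul]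
      rw [map_add, map_smul, map_smul, smul_sub, smul_sub]
      conv_lhs => rw [hv]
      abel
    simp only [e]
    refine (norm_add_le _ _).trans_eq ?_
    rw [norm_smul, norm_smul, Real.norm_of_nonneg ha, Real.norm_of_nonneg hb]
    rfl
  exact h.pow (fun x _ => norm_nonneg _) 2

end Weak

/-! ### The space of paths -/

/-- The Hilbert space of pairs `(w₀, g)` parametrizing the paths `w₀ + ∫₀ᵗ g`. -/
abbrev PathSpace (H : Type*) [NormedAddCommGroup H] (T : ℝ) : Type _ :=
  WithLp 2 (H × Lp H 2 (volI T))

variable {T : ℝ} {A W : H →ₗ.[ℂ] H} {B : ℝ → H →L[ℂ] H}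

omit [InnerProductSpace ℂ H] [CompleteSpace H] in
lemma norm_snd_eq_l2 (x : PathSpace H T) : ‖x.snd‖ = l2 T x.snd := Lp.norm_def _

omit [InnerProductSpace ℂ H] [CompleteSpace H] in
lemma norm_pathSpace_le (x : PathSpace H T) : ‖x‖ ≤ ‖x.fst‖ + ‖x.snd‖ := by
  have h := WithLp.prod_norm_sq_eq_of_L2 x
  refine abs_le_of_sq_le_sq' ?_ (by positivity) |>.2
  nlinarith [norm_nonneg x.fst, norm_nonneg x.snd]

/-- Evaluation of a path at the time `t`. -/
def evalPath (hT : 0 < T) {t : ℝ} (ht : t ∈ Icc 0 T) : PathSpace H T →L[ℂ] H :=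
  LinearMap.mkContinuous
    { toFun := fun x => prim x.fst x.snd t
      map_add' := fun x y => by
        rw [WithLp.add_fst, WithLp.add_snd, prim_congr (Lp.coeFn_add x.snd y.snd) ht]
        exact prim_add hT _ _ (Lp.memLp _) (Lp.memLp _) ht
      map_smul' := fun k x => by
        rw [WithLp.smul_fst, WithLp.smul_snd, prim_congr (Lp.coeFn_smul k x.snd) ht]
        exact prim_smul _ _ _ _ } (1 + √T) fun x => by
    have h1 := norm_prim_le hT x.fst (Lp.memLp x.snd) ht
    rw [← norm_snd_eq_l2] at h1
    have h2 := WithLp.norm_fst_le _ x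
    have h3 := WithLp.norm_snd_le _ x
    calc _ ≤ ‖x.fst‖ + √T * ‖x.snd‖ := h1
      _ ≤ ‖x‖ + √T * ‖x‖ := by gcongr
      _ = _ := by ring

omit [CompleteSpace H] in
lemma evalPath_apply (hT : 0 < T) {t : ℝ} (ht : t ∈ Icc 0 T) (x : PathSpace H T) :
    evalPath hT ht x = prim x.fst x.snd t := rfl

namespace Admissible

variable (h : Admissible T A W B)

/-- The residual as a bounded operator on the space of paths. -/
def residL : PathSpace H T →L[ℂ] Lp H 2 (volI T) :=
  LinearMap.mkContinuousOfExistsBound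
    { toFun := fun x => (h.memLp_resid x.fst (Lp.memLp x.snd)).toLp _
      map_add' := fun x y => by
        rw [← MemLp.toLp_add, MemLp.toLp_eq_toLp_iff, WithLp.add_fst, WithLp.add_snd]
        exact (resid_congr (Lp.coeFn_add x.snd y.snd)).trans
          (h.resid_add _ _ (Lp.memLp _) (Lp.memLp _))
      map_smul' := fun k x => by
        rw [RingHom.id_apply, ← MemLp.toLp_const_smul, MemLp.toLp_eq_toLp_iff, WithLp.smul_fst,
          WithLp.smul_snd]
        exact (resid_congr (Lp.coeFn_smul k x.snd)).trans (h.resid_smul _ _ (Lp.memLp _)) } <| by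
    obtain ⟨K, hK, hb⟩ := h.exists_l2_resid_le
    refine ⟨K * 2, fun x => ?_⟩
    have h1 := hb x.fst x.snd (Lp.memLp _)
    rw [← norm_snd_eq_l2] at h1
    have h2 := WithLp.norm_fst_le _ x
    have h3 := WithLp.norm_snd_le _ x
    calc ‖(h.memLp_resid x.fst (Lp.memLp x.snd)).toLp _‖ = _ := norm_toLp_eq_l2 _
      _ ≤ K * (‖x.fst‖ + ‖x.snd‖) := h1
      _ ≤ K * (‖x‖ + ‖x‖) := by gcongr
      _ = _ := by ring

lemma norm_residL (x : PathSpace H T) : ‖h.residL x‖ = l2 T (resid A W B x.fst x.snd) :=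
  norm_toLp_eq_l2 (h.memLp_resid x.fst (Lp.memLp x.snd))

include h

/-- The energy estimate. -/
lemma norm_evalPath_le {t : ℝ} (ht : t ∈ Icc 0 T) (x : PathSpace H T) :
    ‖evalPath h.pos ht x‖ ≤ ‖x.fst‖ + 2 * (√T * ‖h.residL x‖) := by
  have key : ∀ g : Lp H 2 (volI T), ‖evalPath h.pos ht (WithLp.toLp 2 (x.fst, g))‖ ≤
      ‖x.fst‖ + 2 * (√T * ‖h.residL (WithLp.toLp 2 (x.fst, g))‖) := by
    intro g
    -- Both sides are continuous in `g` for the `L²` norm, so it suffices to treat the dense set of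
    -- bounded continuous functions.
    refine (BoundedContinuousFunction.toLp_denseRange (p := 2) H (volI T) ℂ
      ENNReal.ofNat_ne_top).induction_on (p := fun g : Lp H 2 (volI T) =>
        ‖evalPath h.pos ht (WithLp.toLp 2 (x.fst, g))‖ ≤
          ‖x.fst‖ + 2 * (√T * ‖h.residL (WithLp.toLp 2 (x.fst, g))‖)) g ?_ fun φ => ?_
    · have hc : Continuous fun g : Lp H 2 (volI T) =>
          (WithLp.toLp 2 (x.fst, g) : PathSpace H T) :=
        (WithLp.prod_continuous_toLp 2 H (Lp H 2 (volI T))).comp (by fun_prop)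
      exact isClosed_le ((evalPath h.pos ht).continuous.comp hc).norm
        (continuous_const.add (continuous_const.mul
          (continuous_const.mul (h.residL.continuous.comp hc).norm)))
    · have hae := BoundedContinuousFunction.coeFn_toLp (p := 2) (𝕜 := ℂ) (volI T) φ
      rw [norm_residL, evalPath_apply]
      simp only [WithLp.toLp_fst, WithLp.toLp_snd]
      rw [prim_congr hae ht, l2_congr (resid_congr hae)]
      exact h.norm_prim_le_of_continuous _ φ.continuous ht
  exact key x.snd

/-- Coercivity of the residual together with the initial value. -/
lemma exists_norm_le : ∃ K : ℝ, 0 ≤ K ∧ ∀ x : PathSpace H T,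
    ‖x‖ ≤ K * (‖x.fst‖ + ‖h.residL x‖) := by
  obtain ⟨ε, c, hε, hc, hc1, hb⟩ := exists_resolventBound h.selfAdjoint h.domain_le h.small
  obtain ⟨C, hC⟩ := h.bdd
  have hc1' : 0 < 1 - c := by linarith
  -- The sum of the coefficients of `r` (namely `1` and the `B` term after the energy estimate) and
  -- of `‖w₀‖` (from the `W` and `B` terms).
  set K₁ := 1 + √T * (|C| * (2 * √T)) + c * Real.exp ε + √T * |C| with hK₁
  have hK₁0 : 0 ≤ K₁ := by positivity
  refine ⟨1 + Real.exp (ε * T) * (K₁ / (1 - c)), by positivity, fun x => ?_⟩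
  have hg : MemLp x.snd 2 (volI T) := Lp.memLp _
  obtain ⟨-, h1, h2⟩ := evalOp_prim h.selfAdjoint h.pos h.domain_le hε hb h.closed hc x.fst hg
  have h3 := h.memLp_bdd x.fst hg
  have h4 := h.l2_bdd_le hC x.fst fun t ht => h.norm_evalPath_le ht x
  have hr := h.memLp_resid x.fst hg
  have hrl := h.norm_residL x
  set r := ‖h.residL x‖ with hrdef
  have hr0 : 0 ≤ r := norm_nonneg _
  have ha0 := norm_nonneg x.fst
  -- Take weighted norms in `i g = residual + e^{itA} (W + B) e^{-itA} w`.
  have h5 : l2 T (wt ε x.snd) ≤ l2 T (wt ε (resid A W B x.fst x.snd)) +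
      (l2 T (wt ε fun t => evalOp W (expI A (-t) (prim x.fst x.snd t))) +
        l2 T (wt ε fun t => B t (expI A (-t) (prim x.fst x.snd t)))) := by
    have e1 : ∀ t ∈ Ioo 0 T, ‖wt ε x.snd t‖ ≤ ‖wt ε (resid A W B x.fst x.snd) t +
        wt ε (fun t => expI A t (evalOp W (expI A (-t) (prim x.fst x.snd t)) +
          B t (expI A (-t) (prim x.fst x.snd t)))) t‖ := by
      intro t _
      rw [wt, wt, wt, ← smul_add, norm_smul, norm_smul, resid, sub_add_cancel, norm_smul,
        Complex.norm_I, one_mul]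
    have e2 := l2_add_le (memLp_wt (ε := ε) hr) (memLp_wt (ε := ε) (h.memLp_expI (h1.add h3)))
    have e3 := l2_le ((memLp_wt (ε := ε) hr).add
      (memLp_wt (ε := ε) (h.memLp_expI (h1.add h3)))) e1
    have e4 : l2 T (wt ε fun t => expI A t (evalOp W (expI A (-t) (prim x.fst x.snd t)) +
        B t (expI A (-t) (prim x.fst x.snd t)))) ≤ l2 T (fun t =>
          wt ε (fun t => evalOp W (expI A (-t) (prim x.fst x.snd t))) t +
          wt ε (fun t => B t (expI A (-t) (prim x.fst x.snd t))) t) :=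
      l2_le ((memLp_wt h1).add (memLp_wt h3)) fun t _ => by
        simp only [wt]
        rw [← smul_add, norm_smul, norm_smul, norm_expI h.selfAdjoint]
    have e5 := l2_add_le (memLp_wt (ε := ε) h1) (memLp_wt (ε := ε) h3)
    exact e3.trans (e2.trans (add_le_add le_rfl (e4.trans e5)))
  have h6 := l2_wt_le hε hr
  have h7 := l2_wt_le hε h3
  have h8 := l2_le_wt hε hg
  rw [← hrl] at h6
  -- The `W` term contains `c` times the left side; since `c < 1` it is absorbed, leaving the factor
  -- `1 - c` in the denominator.
  have h9 : l2 T (wt ε x.snd) ≤ K₁ / (1 - c) * (‖x.fst‖ + r) := by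
    rw [div_mul_eq_mul_div, le_div_iff₀ hc1', hK₁]
    have p1 : 0 ≤ √T * (|C| * (2 * √T)) := by positivity
    have p2 : 0 ≤ c * Real.exp ε := by positivity
    have p3 : 0 ≤ √T * |C| := by positivity
    nlinarith [mul_nonneg p1 ha0, mul_nonneg p2 hr0, mul_nonneg p3 hr0]
  have h10 : ‖x.snd‖ ≤ Real.exp (ε * T) * (K₁ / (1 - c)) * (‖x.fst‖ + r) := by
    rw [norm_snd_eq_l2]
    refine h8.trans ?_
    rw [mul_assoc]
    gcongr
  have := norm_pathSpace_le x
  nlinarith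

end Admissible

/-! ### The functional on the space of paths -/

namespace Admissible

variable (h : Admissible T A W B) (u₀ : H)

/-- The least-squares functional on the space of paths. -/
def pathFunctional (x : PathSpace H T) : ℝ := ‖x.fst - u₀‖ ^ 2 + T * ‖h.residL x‖ ^ 2

lemma convexOn_pathFunctional : ConvexOn ℝ univ (h.pathFunctional u₀) := by
  have h1 := convexOn_norm_sub_sq ((evalPath h.pos (left_mem_Icc.2 h.pos.le)).restrictScalars ℝ :
    PathSpace H T →L[ℝ] H) u₀
  have h2 := convexOn_norm_sub_sq (h.residL.restrictScalars ℝ) 0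
  simp only [ContinuousLinearMap.coe_restrictScalars', evalPath_apply, prim_zero, sub_zero] at h1 h2
  exact h1.add (h2.smul h.pos.le)

lemma continuous_pathFunctional : Continuous (h.pathFunctional u₀) := by
  have h1 : Continuous fun x : PathSpace H T => x.fst := WithLp.continuous_fst 2 _ _
  exact ((h1.sub continuous_const).norm.pow 2).add
    (continuous_const.mul (h.residL.continuous.norm.pow 2))

lemma coercive_pathFunctional (a : ℝ) :
    ∃ r, ∀ x : PathSpace H T, h.pathFunctional u₀ x ≤ a → ‖x‖ ≤ r := by
  obtain ⟨K, hK, hb⟩ := h.exists_norm_le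
  refine ⟨K * ((√|a| + ‖u₀‖) + √(|a| / T)), fun x hx => (hb x).trans ?_⟩
  have hT := h.pos
  rw [pathFunctional] at hx
  have h1 : ‖x.fst - u₀‖ ≤ √|a| := by
    refine Real.le_sqrt_of_sq_le (le_trans ?_ (hx.trans (le_abs_self a)))
    have : 0 ≤ T * ‖h.residL x‖ ^ 2 := by positivity
    linarith
  have h2 : ‖h.residL x‖ ≤ √(|a| / T) := by
    refine Real.le_sqrt_of_sq_le ?_
    rw [le_div_iff₀ hT]
    have : 0 ≤ ‖x.fst - u₀‖ ^ 2 := by positivity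
    linarith [le_abs_self a]
  have h3 : ‖x.fst‖ ≤ ‖x.fst - u₀‖ + ‖u₀‖ := by
    simpa using norm_add_le (x.fst - u₀) u₀
  gcongr
  linarith

include h in
lemma residual_ae_eq {w g : ℝ → H} {w₀ : H} (hg : MemLp g 2 (volI T))
    (hw : EqOn w (prim w₀ g) (Icc 0 T)) : residual T A W B w =ᵐ[volI T] resid A W B w₀ g := by
  filter_upwards [weakDeriv_ae_eq h.pos hg hw, ae_restrict_mem measurableSet_Ioo] with t ht hm
  rw [residual, resid, ht, hw (Ioo_subset_Icc_self hm)]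

/-- This carries the minimization to the Hilbert space of pairs; the functional sees the derivative
only up to null sets. -/
lemma lsFunctional_eq {w : ℝ → H} (x : PathSpace H T)
    (hw : EqOn w (prim x.fst x.snd) (Icc 0 T)) :
    lsFunctional T A W B u₀ w = h.pathFunctional u₀ x := by
  have hg : MemLp x.snd 2 (volI T) := Lp.memLp _
  rw [lsFunctional, pathFunctional, norm_residL, hw (left_mem_Icc.2 h.pos.le), prim_zero,
    ← setIntegral_norm_sq_eq (h.memLp_resid _ hg)]
  congr 2
  refine integral_congr_ae ?_
  filter_upwards [h.residual_ae_eq hg hw] with t ht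
  rw [ht]

include h in
-- Each evaluation is bounded, hence continuous for the weak topologies; the constraint set is an
-- intersection of preimages of a weakly closed set.
lemma isClosed_paths {S : Set H} (hS : _root_.IsClosed (toWeakSpace ℂ H '' S)) :
    _root_.IsClosed (toWeakSpace ℂ (PathSpace H T) ''
      {x | ∀ t ∈ Ioo 0 T, prim x.fst x.snd t ∈ S}) := by
  have heq : toWeakSpace ℂ (PathSpace H T) '' {x | ∀ t ∈ Ioo 0 T, prim x.fst x.snd t ∈ S} =
      ⋂ t : Ioo 0 T, (WeakSpace.map (evalPath (H := H) h.pos (Ioo_subset_Icc_self t.2))) ⁻¹'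
        (toWeakSpace ℂ H '' S) := by
    ext y
    obtain ⟨x, rfl⟩ := (toWeakSpace ℂ (PathSpace H T)).surjective y
    simp only [mem_iInter, mem_preimage, (toWeakSpace ℂ (PathSpace H T)).injective.mem_set_image,
      mem_ofPred_eq, Subtype.forall]
    refine forall₂_congr fun t ht => ?_
    exact ((toWeakSpace ℂ H).injective.mem_set_image (s := S)).symm
  rw [heq]
  exact isClosed_iInter fun t => hS.preimage (ContinuousLinearMap.continuous _)

include h in
theorem memLp_residual {w : ℝ → H} (hw : MemH1 T w) :
    (∀ᵐ t ∂(volI T), expI A (-t) (w t) ∈ W.domain) ∧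
      MemLp (residual T A W B w) 2 (volI T) := by
  have hg := (weakDeriv_spec hw).1
  have heq := hw.eq_prim h.pos
  refine ⟨?_, (h.memLp_resid _ hg).ae_eq (h.residual_ae_eq hg heq).symm⟩
  filter_upwards [h.ae_mem_domain (w 0) hg, ae_restrict_mem measurableSet_Ioo] with t ht hm
  rwa [heq (Ioo_subset_Icc_self hm)]

include h in
theorem exists_isMinOn {S : Set H} (hne : S.Nonempty)
    (hS : _root_.IsClosed (toWeakSpace ℂ H '' S)) :
    ∃ v ∈ H1Set T S, IsMinOn (lsFunctional T A W B u₀) (H1Set T S) v := by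
  obtain ⟨s, hs⟩ := hne
  obtain ⟨x, hx, hmin⟩ := exists_isMinOn_of_coercive (h.convexOn_pathFunctional u₀)
    (h.continuous_pathFunctional u₀) (h.coercive_pathFunctional u₀)
    (Z := {x | ∀ t ∈ Ioo 0 T, prim x.fst x.snd t ∈ S})
    -- A constant path at a point of `S` shows that the constraint set is nonempty.
    ⟨WithLp.toLp 2 (s, 0), fun t ht => by
      have e : prim s (0 : Lp H 2 (volI T)) t = s := by
        rw [prim_congr (Lp.coeFn_zero H 2 (volI T)) (Ioo_subset_Icc_self ht)]
        simp [prim]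
      simp only [WithLp.toLp_fst, WithLp.toLp_snd]
      rwa [e]⟩ (h.isClosed_paths hS)
  refine ⟨prim x.fst x.snd, ⟨memH1_of_eqOn_prim h.pos (Lp.memLp _) fun _ _ => rfl, hx⟩, ?_⟩
  rintro w ⟨hw, hwS⟩
  have hg := (weakDeriv_spec hw).1
  have hae := hg.coeFn_toLp
  have heq : EqOn w (prim (w 0) (hg.toLp _)) (Icc 0 T) := fun t ht => by
    rw [hw.eq_prim h.pos ht, prim_congr hae ht]
  have h1 : lsFunctional T A W B u₀ w =
      h.pathFunctional u₀ (WithLp.toLp 2 (w 0, hg.toLp _)) := h.lsFunctional_eq u₀ _ heq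
  change lsFunctional T A W B u₀ (prim x.fst x.snd) ≤ lsFunctional T A W B u₀ w
  rw [h1, h.lsFunctional_eq u₀ x fun _ _ => rfl]
  refine hmin fun t ht => ?_
  have h2 := hwS t ht
  rwa [heq (Ioo_subset_Icc_self ht)] at h2

end Admissible

end SchrodingerLS

end

/-! ### The main theorem. -/

theorem mainTheorem4 {H : Type*} [NormedAddCommGroup H] [InnerProductSpace ℂ H] [CompleteSpace H]
    [TopologicalSpace.SeparableSpace H]
    (T : ℝ) (hT : 0 < T)
    (H₀ W : H →ₗ.[ℂ] H) (hH₀ : IsSelfAdjoint H₀)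
    (hW_closed : W.IsClosed) (hW_symm : W.IsFormalAdjoint W)
    (hdom : H₀.domain ≤ W.domain)
    (hsmall : SchrodingerLS.IsSmallPerturbation W H₀)
    (B : ℝ → H →L[ℂ] H)
    (hB_sa : ∀ t ∈ Ioo 0 T, IsSelfAdjoint (B t))
    (hB_cont : ∀ x : H, ContinuousOn (fun t => B t x) (Ioo 0 T))
    (hB_bdd : ∃ C : ℝ, ∀ t ∈ Ioo 0 T, ‖B t‖ ≤ C)
    (u₀ : H) :
    (∀ w : ℝ → H, SchrodingerLS.MemH1 T w →
      (∀ᵐ t ∂(SchrodingerLS.volI T), SchrodingerLS.expI H₀ (-t) (w t) ∈ W.domain) ∧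
      MemLp (SchrodingerLS.residual T H₀ W B w) 2 (SchrodingerLS.volI T)) ∧
    ∀ S : Set H, S.Nonempty → _root_.IsClosed (toWeakSpace ℂ H '' S) →
      ∃ v ∈ SchrodingerLS.H1Set T S,
        IsMinOn (SchrodingerLS.lsFunctional T H₀ W B u₀) (SchrodingerLS.H1Set T S) v := by
  obtain h : SchrodingerLS.Admissible T H₀ W B :=
    ⟨hT, hH₀, hW_closed, hW_symm, hdom, hsmall, hB_sa, hB_cont, hB_bdd⟩
  exact ⟨fun w hw => h.memLp_residual hw, fun S hne hS => h.exists_isMinOn u₀ hne hS⟩
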